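/- Let $n\in\mathbb N$ and $\alpha,\beta\in\mathbb R$ with $\alpha,\beta,\alpha+\beta\notin\mathbb Z$, let $\mathcal P_m$ be the space of complex polynomials of degree $\le m$ ($\mathcal P_m^*$: degree exactly $m$), and let $$P_n^{(\alpha,\beta)}(z)=2^{-n}\sum_{k=0}^n\binom{n+\alpha}{n-k}\binom{n+\beta}{k}(z-1)^k(z+1)^{n-k}$$ be the Jacobi polynomial. Let $w(z;\alpha,\beta)=(1-z)^\alpha(z+1)^\beta=\exp[\alpha\log(1-z)+\beta\log(z+1)]$, a multivalued function; in the integrals below, $w$ denotes any branch that is continuous along the path of integration (endpoints excluded). Curves are continuous, differentiable off a countable set, with locally integrable derivative (for instance piecewise $C^1$), parametrized by $(0,1)$, and: * $\Gamma_1$ is any curve in $\mathbb C\setminus[-1,+\infty)$ from $1-i0$ to $1+i0$, i.e. it tends to $1$ at both ends, from below at its start and from above at its end; * $\Gamma_{-1}$ is any curve in $\mathbb C\setminus(-\infty,1]$ from $-1+i0$ to $-1-i0$; * $\Gamma_\infty$ is any curve in $\mathbb C\setminus\big((-\infty,-1]\cup[1,+\infty)\big)$ that comes from $\infty$ in the upper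 half plane and goes to $\infty$ in the lower half plane. Integrals along curves are improper at both ends; integrals over $\Delta$ are Lebesgue integrals. Assume that exactly one of the three conditions $\alpha>-1$, $\beta>-1$, $2n+\alpha+\beta<0$ holds, and that $-n<\alpha<-1$ or $-n<\beta<-1$. Let $\gamma,\Delta,\alpha_1,\beta_1,k$ be given by the row of the following table whose condition holds ($[c]$ is the largest integer $\le c$): | Case | $\gamma$ | $\Delta$ | $\alpha_1$ | $\beta_1$ | $k$ | |---|---|---|---|---|---| | $\alpha>-1,\ -n<\beta<-1$ | $\Gamma_1$ | $[-1,1]$ | $\alpha$ | $\beta+[-\beta]$ | $[-\beta]$ | | $\beta>-1,\ -n<\alpha<-1$ | $\Gamma_{-1}$ | $[-1,1]$ | $\alpha+[-\alpha]$ | $\beta$ | $[-\alpha]$ | | $2n+\alpha+\beta<0,\ -n<\beta<-1$ | $\Gamma_\infty$ | $(-\infty,-1]$ | $\alpha$ | $\beta+[-\beta]$ | $[-\beta]$ | | $2n+\alpha+\beta<0,\ -n<\alpha<-1$ | $\Gamma_\infty$ | $[1,+\infty)$ | $\alpha+[-\alpha]$ | $\beta$ | $[-\alpha]$ | Then $P_n^{(\alpha,\beta)}$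 has degree exactly $n$, and the following hold, with convergent integrals unless divergence is stated: 1. $\int_\gamma q(t)P_n^{(\alpha,\beta)}(t)\,w(t;\alpha,\beta)\,dt=0$ for all $q\in\mathcal P_{k-1}$; 2. $\int_\Delta q(t)P_n^{(\alpha,\beta)}(t)\,w(t;\alpha_1,\beta_1)\,dt=0$ for all $q\in\mathcal P_{n-k-1}$; 3. for all $q\in\mathcal P_{n-k}^*$ the integral in 2 converges and is $\ne0$, except if $-1<2n+\alpha+\beta<0$, when it diverges (both as a Lebesgue integral and as the limit of the integrals over $\Delta\cap[-R,R]$, $R\to\infty$). Moreover, the conditions 1 and 2 characterize $P_n^{(\alpha,\beta)}$ up to a constant factor: a polynomial $p\in\mathcal P_n$ satisfies 1 and 2 in place of $P_n^{(\alpha,\beta)}$ if and only if $p=c\,P_n^{(\alpha,\beta)}$ for some $c\in\mathbb C$. -/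

import Mathlib

open Polynomial Set Filter Topology MeasureTheory

noncomputable section

namespace JacobiOrth

/-- The Jacobi polynomial
`2⁻ⁿ ∑ₖ binom(n+α, n-k) binom(n+β, k) (z-1)ᵏ (z+1)ⁿ⁻ᵏ`, with generalized binomial coefficients. -/
def jacobi (n : ℕ) (α β : ℂ) : ℂ[X] :=
  C ((2 : ℂ)⁻¹ ^ n) * ∑ k ∈ Finset.range (n + 1),
    C (Ring.choose ((n : ℂ) + α) (n - k) * Ring.choose ((n : ℂ) + β) k) *
      (X - 1) ^ k * (X + 1) ^ (n - k)

/-- The values at `z` of the multivalued weight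
`w(z; α, β) = (1 - z)^α (z + 1)^β = exp (α log (1 - z) + β log (z + 1))`,
over all choices of the two logarithms. -/
def weightValues (α β : ℝ) (z : ℂ) : Set ℂ :=
  {w | ∃ a b : ℂ, Complex.exp a = 1 - z ∧ Complex.exp b = z + 1 ∧
    w = Complex.exp ((α : ℂ) * a + (β : ℂ) * b)}

/-- `W` is a continuous branch of `w(·; α, β)` along the curve `γ`, parametrized by `I`. -/
def IsWeightBranch (α β : ℝ) (γ : ℝ → ℂ) (I : Set ℝ) (W : ℝ → ℂ) : Prop :=
  ContinuousOn W I ∧ ∀ s ∈ I, W s ∈ weightValues α β (γ s)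

/-- Curves without their endpoints, parametrized by the open interval `(0, 1)`: continuous,
differentiable off a countable set, with locally integrable derivative. All piecewise `C¹` curves
are of this kind. -/
structure IsCurve (γ : ℝ → ℂ) : Prop where
  continuousOn : ContinuousOn γ (Ioo 0 1)
  differentiable : ∃ S : Set ℝ, S.Countable ∧ ∀ s ∈ Ioo (0 : ℝ) 1 \ S, DifferentiableAt ℝ γ s
  locallyIntegrable : LocallyIntegrableOn (deriv γ) (Ioo 0 1)

/-- `Γ₁`: a curve from `1 - i0` to `1 + i0` in `ℂ \ [-1, ∞)`, apart from its endpoints. -/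
structure IsGammaOne (γ : ℝ → ℂ) : Prop where
  isCurve : IsCurve γ
  avoids : ∀ s ∈ Ioo (0 : ℝ) 1, ¬ ((γ s).im = 0 ∧ -1 ≤ (γ s).re)
  start : Tendsto γ (𝓝[>] 0) (𝓝 1)
  start_below : ∀ᶠ s in 𝓝[>] 0, (γ s).im < 0
  finish : Tendsto γ (𝓝[<] 1) (𝓝 1)
  finish_above : ∀ᶠ s in 𝓝[<] 1, 0 < (γ s).im

/-- `Γ₋₁`: a curve from `-1 + i0` to `-1 - i0` in `ℂ \ (-∞, 1]`, apart from its endpoints. -/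
structure IsGammaNegOne (γ : ℝ → ℂ) : Prop where
  isCurve : IsCurve γ
  avoids : ∀ s ∈ Ioo (0 : ℝ) 1, ¬ ((γ s).im = 0 ∧ (γ s).re ≤ 1)
  start : Tendsto γ (𝓝[>] 0) (𝓝 (-1))
  start_above : ∀ᶠ s in 𝓝[>] 0, 0 < (γ s).im
  finish : Tendsto γ (𝓝[<] 1) (𝓝 (-1))
  finish_below : ∀ᶠ s in 𝓝[<] 1, (γ s).im < 0

/-- `Γ_∞`: a curve in `ℂ \ ((-∞, -1] ∪ [1, ∞))` coming from infinity in the upper half plane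
and going to infinity in the lower half plane. -/
structure IsGammaInfty (γ : ℝ → ℂ) : Prop where
  isCurve : IsCurve γ
  avoids : ∀ s ∈ Ioo (0 : ℝ) 1, ¬ ((γ s).im = 0 ∧ ((γ s).re ≤ -1 ∨ 1 ≤ (γ s).re))
  start : Tendsto (fun s => ‖γ s‖) (𝓝[>] 0) atTop
  start_above : ∀ᶠ s in 𝓝[>] 0, 0 < (γ s).im
  finish : Tendsto (fun s => ‖γ s‖) (𝓝[<] 1) atTop
  finish_below : ∀ᶠ s in 𝓝[<] 1, (γ s).im < 0

/-- The (improper) integral along `γ`, of the integrand with value `f s` at the point `γ s`,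
converges and equals `L`. Improper at both endpoints; it agrees with the Lebesgue
integral of `f * γ'` whenever the latter converges absolutely. -/
def HasCurveIntegral (γ f : ℝ → ℂ) (L : ℂ) : Prop :=
  LocallyIntegrableOn (fun s => f s * deriv γ s) (Ioo 0 1) ∧
    Tendsto (fun e : ℝ × ℝ => ∫ s in e.1..e.2, f s * deriv γ s)
      (𝓝[>] 0 ×ˢ 𝓝[<] 1) (𝓝 L)

/-- `p` is orthogonal along `γ`, with weight `W`, to all polynomials of degree `< k`. -/
def OrthOnCurve (γ W : ℝ → ℂ) (k : ℕ) (p : ℂ[X]) : Prop :=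
  ∀ q : ℂ[X], q.degree < k →
    HasCurveIntegral γ (fun s => q.eval (γ s) * p.eval (γ s) * W s) 0

/-- The integrand `q p V` on a real interval. -/
def realIntegrand (V : ℝ → ℂ) (q p : ℂ[X]) (t : ℝ) : ℂ :=
  q.eval (t : ℂ) * p.eval (t : ℂ) * V t

/-- `p` is orthogonal on `Δ`, with weight `V`, to all polynomials of degree `< m`. -/
def OrthOnInterval (Δ : Set ℝ) (V : ℝ → ℂ) (m : ℕ) (p : ℂ[X]) : Prop :=
  ∀ q : ℂ[X], q.degree < m →
    IntegrableOn (realIntegrand V q p) Δ ∧ ∫ t in Δ, realIntegrand V q p t = 0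

/-- The integral of `f` over `Δ` diverges, as a Lebesgue integral and also as a limit of
integrals over bounded intervals. -/
def DivergesOn (Δ : Set ℝ) (f : ℝ → ℂ) : Prop :=
  ¬ IntegrableOn f Δ ∧
    ¬ ∃ L : ℂ, Tendsto (fun R : ℝ => ∫ t in Δ ∩ Icc (-R) R, f t) atTop (𝓝 L)

/-- The multiple orthogonality of the Jacobi polynomial, and the characterization by it, for one
row `(γ, Δ, α₁, β₁, k)` of the table. The open interval `Δ` stands for its closure, and the curve
`γ` and the branches of the weights are arbitrary of their kind. -/
def MultipleOrthogonality (n : ℕ) (α β : ℝ) (IsGamma : (ℝ → ℂ) → Prop) (Δ : Set ℝ)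
    (α₁ β₁ : ℝ) (k : ℕ) : Prop :=
  ∀ γ W V : ℝ → ℂ, IsGamma γ → IsWeightBranch α β γ (Ioo 0 1) W →
    IsWeightBranch α₁ β₁ (fun t => (t : ℂ)) Δ V →
    OrthOnCurve γ W k (jacobi n α β) ∧
    OrthOnInterval Δ V (n - k) (jacobi n α β) ∧
    (∀ q : ℂ[X], q.degree = ((n - k : ℕ) : WithBot ℕ) →
      (¬ (-1 < 2 * n + α + β ∧ 2 * n + α + β < 0) →
        IntegrableOn (realIntegrand V q (jacobi n α β)) Δ ∧
          ∫ t in Δ, realIntegrand V q (jacobi n α β) t ≠ 0) ∧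
      (-1 < 2 * n + α + β ∧ 2 * n + α + β < 0 →
        DivergesOn Δ (realIntegrand V q (jacobi n α β)))) ∧
    (∀ p : ℂ[X], p.degree ≤ n →
      (OrthOnCurve γ W k p ∧ OrthOnInterval Δ V (n - k) p ↔
        ∃ c : ℂ, p = C c * jacobi n α β))

end JacobiOrth

end

/-! Write `w` for the weight and `T g` for `pearson α β g`, so that `(1 - z²) g w` has derivative
`(T g) w`. Since `α + β` is not an integer, `T` raises every degree by exactly one, and every
polynomial is uniquely a constant plus an element of the range of `T` (`exists_eq_C_add_pearson`,
`pearson_eq_C`). An integral against `w` whose boundary terms vanish kills the range of `T`; if it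
is not identically zero, its kernel is therefore exactly that range, whatever the path
(`PearsonFunctional.eq_zero_iff`). Every orthogonality relation thus becomes a membership statement
`q * p ∈ range T`, and the rest is algebra.

The algebra rests on two facts. A Rodrigues formula `pearson_jacobi` and the product rule reduce
membership of `q P_n` to that of `q' P_{n-1}` with both exponents raised by one
(`mul_jacobi_succ_mem_range`). Hence `q P_n` lies in the range for `deg q < n` and does not for `deg
q = n`, which also gives uniqueness (`eq_C_mul_jacobi`). Moreover `(1 + X)^k f` is in the range for
`β` iff `f` is in the range for `β + k` (`one_add_X_pow_mul_mem_range`). So division of the test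
polynomial by `(1 + X)^k` splits the `n` conditions into the `k` conditions on the curve and the `n
- k` conditions on the interval (`forall_mul_mem_range_iff`).

The analytic part shows that each integral is such a functional up to the degree needed. On
intervals the weight is a constant times a positive function, so it is nonzero at `1`. On curves an
explicit primitive of the weight times a polynomial has different limits at the two ends, because an
exponent is not an integer (`exists_primitive`); a Möbius map carries this from curves at `1` to
curves at infinity. The remaining rows follow by `z ↦ -z`, which exchanges `α` and `β`. -/

noncomputable section

namespace JacobiOrth

/-! ### The Pearson operator -/

/-- The Pearson operator `g ↦ (1 - X²) g' - ((β + 1) (X - 1) + (α + 1) (X + 1)) g`: the derivative of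
`(1 - z²) g(z) w(z; α, β)` is `(pearson α β g)(z) w(z; α, β)`. -/
def pearson (α β : ℂ) : ℂ[X] →ₗ[ℂ] ℂ[X] :=
  LinearMap.mulLeft ℂ (1 - X ^ 2) ∘ₗ derivative -
    LinearMap.mulLeft ℂ (C (β + 1) * (X - 1) + C (α + 1) * (X + 1))

theorem pearson_apply (α β : ℂ) (g : ℂ[X]) :
    pearson α β g =
      (1 - X ^ 2) * derivative g - (C (β + 1) * (X - 1) + C (α + 1) * (X + 1)) * g := rfl

theorem eval_pearson (α β z : ℂ) (g : ℂ[X]) :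
    (pearson α β g).eval z =
      (1 - z ^ 2) * (derivative g).eval z - ((β + 1) * (z - 1) + (α + 1) * (z + 1)) * g.eval z := by
  simp [pearson_apply]

theorem coeff_pearson_succ (α β : ℂ) {g : ℂ[X]} {j : ℕ} (hg : g.natDegree ≤ j) :
    (pearson α β g).coeff (j + 1) = -(j + α + β + 2) * g.coeff j := by
  have h : pearson α β g = derivative g - X * (X * derivative g) - C (α + β + 2) * (X * g)
      + C (β - α) * g := by
    rw [pearson_apply]; simp only [C_add, C_sub, C_1, C_ofNat]; ring
  have h1 : g.coeff (j + 1) = 0 := coeff_eq_zero_of_natDegree_lt (by omega)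
  have h2 : g.coeff (j + 1 + 1) = 0 := coeff_eq_zero_of_natDegree_lt (by omega)
  rw [h]
  simp only [coeff_add, coeff_sub, coeff_C_mul, coeff_X_mul, coeff_derivative, h1, h2]
  rcases j with _ | j
  · simp; ring
  · simp only [coeff_X_mul, coeff_derivative]; push_cast; ring

theorem natDegree_pearson_le (α β : ℂ) (g : ℂ[X]) :
    (pearson α β g).natDegree ≤ g.natDegree + 1 := by
  rcases Nat.eq_zero_or_pos g.natDegree with h0 | h0
  · rw [pearson_apply, natDegree_eq_zero.1 h0 |>.choose_spec.symm]
    simp only [derivative_C, mul_zero, zero_sub, natDegree_neg, natDegree_C]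
    compute_degree
  · have := natDegree_derivative_lt h0.ne'
    rw [pearson_apply]
    refine (natDegree_sub_le _ _).trans (max_le ?_ ?_)
    · refine natDegree_mul_le.trans ?_
      have : (1 - X ^ 2 : ℂ[X]).natDegree ≤ 2 := by compute_degree
      omega
    · refine natDegree_mul_le.trans ?_
      have : (C (β + 1) * (X - 1) + C (α + 1) * (X + 1) : ℂ[X]).natDegree ≤ 1 := by compute_degree
      omega

/-- The leading coefficient of `g` gets multiplied by `-(deg g + α + β + 2)`, which cannot vanish
when `α + β` is not an integer. -/
theorem natDegree_pearson {α β : ℂ} (hαβ : ∀ m : ℤ, α + β ≠ m) {g : ℂ[X]} (hg : g ≠ 0) :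
    (pearson α β g).natDegree = g.natDegree + 1 := by
  refine le_antisymm (natDegree_pearson_le α β g) (le_natDegree_of_ne_zero ?_)
  rw [coeff_pearson_succ α β le_rfl]
  refine mul_ne_zero (neg_ne_zero.2 fun h => hαβ (-(g.natDegree + 2)) ?_) (by simpa using hg)
  push_cast; linear_combination h

theorem pearson_eq_C {α β : ℂ} (hαβ : ∀ m : ℤ, α + β ≠ m) {g : ℂ[X]} {c : ℂ}
    (h : pearson α β g = C c) : c = 0 := by
  by_cases hg : g = 0
  · simpa [hg] using h.symm
  · have := natDegree_pearson hαβ hg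
    simp [h] at this

/-- Leading terms are removed one at a time by images of monomials. With `pearson_eq_C`, the
cokernel of the operator is one-dimensional, spanned by the class of `1`. -/
theorem exists_eq_C_add_pearson {α β : ℂ} (hαβ : ∀ m : ℤ, α + β ≠ m) (f : ℂ[X]) :
    ∃ c g, f = C c + pearson α β g := by
  induction h : f.natDegree using Nat.strong_induction_on generalizing f with
  | _ d ih =>
    rcases d with _ | d
    · obtain ⟨c, rfl⟩ := natDegree_eq_zero.1 h
      exact ⟨c, 0, by simp⟩
    · have h0 : -((d : ℂ) + α + β + 2) ≠ 0 := neg_ne_zero.2 fun h => hαβ (-(d + 2)) (by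
        push_cast; linear_combination h)
      set a := f.coeff (d + 1) / -((d : ℂ) + α + β + 2) with ha
      have hm : (C a * X ^ d : ℂ[X]).natDegree ≤ d := natDegree_C_mul_X_pow_le a d
      have hlt : (f - pearson α β (C a * X ^ d)).natDegree < d + 1 := by
        refine Nat.lt_succ_of_le (natDegree_le_iff_coeff_eq_zero.2 fun N hN => ?_)
        rcases Nat.lt_or_eq_of_le (Nat.succ_le_of_lt hN) with hN | rfl
        · rw [coeff_sub, coeff_eq_zero_of_natDegree_lt (by omega), coeff_eq_zero_of_natDegree_lt
            ((natDegree_pearson_le _ _ _).trans_lt (by omega)), sub_zero]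
        · rw [coeff_sub, Nat.succ_eq_add_one, coeff_pearson_succ α β hm, coeff_C_mul_X_pow, if_pos rfl, ha,
            mul_div_cancel₀ _ h0, sub_self]
      obtain ⟨c, g, hg⟩ := ih _ hlt _ rfl
      refine ⟨c, g + C a * X ^ d, ?_⟩
      rw [map_add, ← add_assoc, ← hg]; ring

/-! ### Product rule and integer shifts of the exponents -/

theorem mul_pearson (α β : ℂ) (q g : ℂ[X]) :
    q * pearson α β g = pearson α β (q * g) - (1 - X ^ 2) * (derivative q * g) := by
  simp only [pearson_apply, derivative_mul]; ring

theorem pearson_one_add_X_mul (α β : ℂ) (g : ℂ[X]) :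
    pearson α β ((1 + X) * g) = (1 + X) * pearson α (β + 1) g := by
  simp only [pearson_apply, derivative_mul, derivative_add, derivative_one, derivative_X, C_add,
    C_1]
  ring

theorem pearson_one_sub_X_mul (α β : ℂ) (g : ℂ[X]) :
    pearson α β ((1 - X) * g) = (1 - X) * pearson (α + 1) β g := by
  simp only [pearson_apply, derivative_mul, derivative_sub, derivative_one, derivative_X, C_add,
    C_1]
  ring

/-- At `-1` the image of `h` takes the value `2 (β + 1) h(-1)`. If the image is divisible by `1 +
X`, then so is `h`, because `β ≠ -1`, and the common factor can be moved into the weight. -/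
theorem one_add_X_mul_mem_range {α β : ℂ} (hβ : ∀ m : ℤ, β ≠ m) {f : ℂ[X]} :
    (1 + X) * f ∈ LinearMap.range (pearson α β) ↔ f ∈ LinearMap.range (pearson α (β + 1)) := by
  have h0 : (1 + X : ℂ[X]) ≠ 0 := by
    intro h; simpa using congrArg (eval 0) h
  constructor
  · rintro ⟨h, hh⟩
    have h1 : h.IsRoot (-1) := by
      have := congrArg (eval (-1)) hh
      rw [eval_pearson] at this
      simp at this
      refine this.resolve_left fun h => ?_
      rcases h with h | h
      · exact hβ (-1) (by push_cast; linear_combination h)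
      · norm_num at h
    obtain ⟨g, rfl⟩ := dvd_iff_isRoot.2 h1
    refine ⟨g, mul_left_cancel₀ h0 ?_⟩
    rw [← hh, ← pearson_one_add_X_mul, C_neg, C_1, sub_neg_eq_add, add_comm X]
  · rintro ⟨g, rfl⟩
    exact ⟨_, pearson_one_add_X_mul α β g⟩

theorem one_sub_X_mul_mem_range {α β : ℂ} (hα : ∀ m : ℤ, α ≠ m) {f : ℂ[X]} :
    (1 - X) * f ∈ LinearMap.range (pearson α β) ↔ f ∈ LinearMap.range (pearson (α + 1) β) := by
  have h0 : (1 - X : ℂ[X]) ≠ 0 := by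
    intro h; simpa using congrArg (eval 0) h
  constructor
  · rintro ⟨h, hh⟩
    have h1 : h.IsRoot 1 := by
      have := congrArg (eval 1) hh
      rw [eval_pearson] at this
      simp at this
      rcases this with h | h
      · exact absurd (by push_cast; linear_combination h) (hα (-1))
      · exact h
    obtain ⟨g, rfl⟩ := dvd_iff_isRoot.2 h1
    refine ⟨-g, mul_left_cancel₀ h0 ?_⟩
    rw [← hh, ← pearson_one_sub_X_mul, C_1]
    congr 1; ring
  · rintro ⟨g, rfl⟩
    exact ⟨_, pearson_one_sub_X_mul α β g⟩

theorem one_add_X_pow_mul_mem_range {α β : ℂ} (hβ : ∀ m : ℤ, β ≠ m) (k : ℕ) {f : ℂ[X]} :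
    (1 + X) ^ k * f ∈ LinearMap.range (pearson α β) ↔
      f ∈ LinearMap.range (pearson α (β + k)) := by
  induction k generalizing β with
  | zero => simp
  | succ k ih =>
    rw [pow_succ', mul_assoc, one_add_X_mul_mem_range hβ, ih fun m h => hβ (m - 1) (by
      push_cast; linear_combination h)]
    push_cast
    rw [add_right_comm, add_assoc β]

theorem one_sub_X_sq_mul_mem_range {α β : ℂ} (hα : ∀ m : ℤ, α ≠ m) (hβ : ∀ m : ℤ, β ≠ m)
    {f : ℂ[X]} :
    (1 - X ^ 2) * f ∈ LinearMap.range (pearson α β) ↔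
      f ∈ LinearMap.range (pearson (α + 1) (β + 1)) := by
  rw [show (1 - X ^ 2 : ℂ[X]) * f = (1 + X) * ((1 - X) * f) by ring, one_add_X_mul_mem_range hβ,
    one_sub_X_mul_mem_range hα]

/-! ### Jacobi polynomials -/

theorem succ_mul_choose_succ (r : ℂ) (k : ℕ) :
    ((k : ℂ) + 1) * Ring.choose r (k + 1) = (r - k) * Ring.choose r k := by
  have := Ring.choose_smul_choose r (Nat.le_succ k)
  simp only [Nat.succ_eq_add_one, Nat.choose_succ_self_right, Nat.add_sub_cancel_left,
    Ring.choose_one_right, nsmul_eq_mul] at this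
  push_cast at this
  linear_combination this

theorem pearson_X_sub_one_pow_mul (α β : ℂ) (k l : ℕ) :
    pearson α β ((X - 1) ^ k * (X + 1) ^ l) =
      -(C (k + α + 1) * ((X - 1) ^ k * (X + 1) ^ (l + 1))) -
        C (l + β + 1) * ((X - 1) ^ (k + 1) * (X + 1) ^ l) := by
  rw [pearson_apply, derivative_mul, derivative_pow, derivative_pow]
  simp only [derivative_add, derivative_sub, derivative_X, derivative_one, C_add, C_1]
  rcases k with _ | k <;> rcases l with _ | l <;> simp <;> ring

/-- One step of the Rodrigues formula. Each product `(X - 1)^k (X + 1)^l` is sent to a combination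
of its two neighbours of degree one higher, and the binomial recurrence turns the coefficients into
those of the next Jacobi polynomial. -/
theorem pearson_jacobi (n : ℕ) (α β : ℂ) :
    pearson α β (jacobi n (α + 1) (β + 1)) = C (-2 * ((n : ℂ) + 1)) * jacobi (n + 1) α β := by
  have hterm : ∀ k ∈ Finset.range (n + 1),
      pearson α β (C (Ring.choose ((n : ℂ) + (α + 1)) (n - k) *
        Ring.choose ((n : ℂ) + (β + 1)) k) * (X - 1) ^ k * (X + 1) ^ (n - k)) =
      -(C ((n + 1 - k : ℂ) * (Ring.choose ((n + 1 : ℂ) + α) (n + 1 - k) *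
        Ring.choose ((n + 1 : ℂ) + β) k)) * ((X - 1) ^ k * (X + 1) ^ (n + 1 - k)) +
      C ((k + 1 : ℂ) * (Ring.choose ((n + 1 : ℂ) + α) (n + 1 - (k + 1)) *
        Ring.choose ((n + 1 : ℂ) + β) (k + 1))) *
          ((X - 1) ^ (k + 1) * (X + 1) ^ (n + 1 - (k + 1)))) := by
    intro k hk
    obtain ⟨l, rfl⟩ := Nat.exists_eq_add_of_le (Nat.lt_succ_iff.1 (Finset.mem_range.1 hk))
    have e1 : k + l - k = l := by omega
    have e2 : k + l + 1 - k = l + 1 := by omega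
    have e3 : k + l + 1 - (k + 1) = l := by omega
    rw [mul_assoc, ← smul_eq_C_mul, map_smul, e1, e2, e3, pearson_X_sub_one_pow_mul, smul_eq_C_mul]
    have h1 := succ_mul_choose_succ (((k + l : ℕ) : ℂ) + 1 + α) l
    have h2 := succ_mul_choose_succ (((k + l : ℕ) : ℂ) + 1 + β) k
    rw [show ((k + l : ℕ) : ℂ) + (α + 1) = ((k + l : ℕ) : ℂ) + 1 + α by ring,
      show ((k + l : ℕ) : ℂ) + (β + 1) = ((k + l : ℕ) : ℂ) + 1 + β by ring]
    set A := Ring.choose (((k + l : ℕ) : ℂ) + 1 + α) l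
    set A' := Ring.choose (((k + l : ℕ) : ℂ) + 1 + α) (l + 1)
    set B := Ring.choose (((k + l : ℕ) : ℂ) + 1 + β) k
    set B' := Ring.choose (((k + l : ℕ) : ℂ) + 1 + β) (k + 1)
    push_cast at h1 h2 ⊢
    have h3 : C (A * B) * C ((k : ℂ) + α + 1) = C ((k + l + 1 - k) * (A' * B)) := by
      rw [← C_mul]; congr 1; linear_combination -B * h1
    have h4 : C (A * B) * C ((l : ℂ) + β + 1) = C ((k + 1) * (A * B')) := by
      rw [← C_mul]; congr 1; linear_combination -A * h2
    rw [← h3, ← h4]; ring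
  have hsum : ∑ k ∈ Finset.range (n + 1),
      pearson α β (C (Ring.choose ((n : ℂ) + (α + 1)) (n - k) *
        Ring.choose ((n : ℂ) + (β + 1)) k) * (X - 1) ^ k * (X + 1) ^ (n - k)) =
      -(C ((n : ℂ) + 1) * ∑ k ∈ Finset.range (n + 1 + 1),
        C (Ring.choose ((n + 1 : ℂ) + α) (n + 1 - k) * Ring.choose ((n + 1 : ℂ) + β) k) *
          (X - 1) ^ k * (X + 1) ^ (n + 1 - k)) := by
    rw [Finset.sum_congr rfl hterm, Finset.sum_neg_distrib, Finset.sum_add_distrib]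
    congr 1
    set t : ℕ → ℂ[X] := fun k => (C (Ring.choose ((n + 1 : ℂ) + α) (n + 1 - k) *
      Ring.choose ((n + 1 : ℂ) + β) k)) * ((X - 1) ^ k * (X + 1) ^ (n + 1 - k)) with ht
    -- Both sums extend to `k ≤ n + 1` because the added term has coefficient zero. The two
    -- coefficients `n + 1 - k` and `k` then add up to `n + 1` for every `k`.
    have hA : ∑ k ∈ Finset.range (n + 1), C ((n + 1 - k : ℂ)) * t k =
        ∑ k ∈ Finset.range (n + 1 + 1), C ((n + 1 - k : ℂ)) * t k := by
      rw [Finset.sum_range_succ _ (n + 1)]; simp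
    have hB : ∑ k ∈ Finset.range (n + 1), C ((k + 1 : ℂ)) * t (k + 1) =
        ∑ k ∈ Finset.range (n + 1 + 1), C ((k : ℂ)) * t k := by
      rw [Finset.sum_range_succ' _ (n + 1)]; simp
    simp only [C_mul, mul_assoc, ht] at hA hB ⊢
    rw [hA, hB, ← Finset.sum_add_distrib, Finset.mul_sum]
    refine Finset.sum_congr rfl fun k _ => ?_
    rw [← add_mul, ← C_add]
    congr 2; ring
  rw [jacobi, jacobi, ← smul_eq_C_mul, map_smul, map_sum, hsum, smul_eq_C_mul]
  push_cast
  rw [pow_succ, C_mul (a := 2⁻¹ ^ n), show C (-2 * ((n : ℂ) + 1)) = -(C 2 * C ((n : ℂ) + 1)) by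
    rw [← C_mul, ← C_neg]; congr 1; ring]
  have h2 : (C 2 * C (2 : ℂ)⁻¹ : ℂ[X]) = 1 := by rw [← C_mul]; simp
  linear_combination (C (2⁻¹ ^ n) * (C ((n : ℂ) + 1) * ∑ k ∈ Finset.range (n + 1 + 1),
        C (Ring.choose ((n + 1 : ℂ) + α) (n + 1 - k) * Ring.choose ((n + 1 : ℂ) + β) k) *
          (X - 1) ^ k * (X + 1) ^ (n + 1 - k))) * h2

theorem jacobi_zero (α β : ℂ) : jacobi 0 α β = 1 := by simp [jacobi]

/-- `α`, `β` and `α + β` are not integers. -/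
structure NonInt (α β : ℂ) : Prop where
  left : ∀ m : ℤ, α ≠ m
  right : ∀ m : ℤ, β ≠ m
  sum : ∀ m : ℤ, α + β ≠ m

theorem NonInt.add_one {α β : ℂ} (h : NonInt α β) : NonInt (α + 1) (β + 1) where
  left m hm := h.left (m - 1) (by push_cast; linear_combination hm)
  right m hm := h.right (m - 1) (by push_cast; linear_combination hm)
  sum m hm := h.sum (m - 2) (by push_cast; linear_combination hm)

theorem jacobi_succ (n : ℕ) (α β : ℂ) :
    jacobi (n + 1) α β = C (-2 * ((n : ℂ) + 1))⁻¹ * pearson α β (jacobi n (α + 1) (β + 1)) := by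
  have h : (-2 * ((n : ℂ) + 1)) ≠ 0 := mul_ne_zero (by norm_num) n.cast_add_one_ne_zero
  rw [pearson_jacobi, ← mul_assoc, ← C_mul, inv_mul_cancel₀ h, C_1, one_mul]

theorem degree_jacobi (n : ℕ) {α β : ℂ} (h : NonInt α β) : (jacobi n α β).degree = n := by
  induction n generalizing α β with
  | zero => simp [jacobi_zero]
  | succ n ih =>
    have h0 : (-2 * ((n : ℂ) + 1)) ≠ 0 := mul_ne_zero (by norm_num) n.cast_add_one_ne_zero
    have hd := ih h.add_one
    have hj : jacobi n (α + 1) (β + 1) ≠ 0 := fun h => by simp [h] at hd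
    have := natDegree_pearson h.sum hj
    rw [jacobi_succ, degree_C_mul (inv_ne_zero h0), degree_eq_natDegree, this,
      natDegree_eq_of_degree_eq_some hd]
    rintro h0
    simp [h0] at this

/-- Integration by parts in algebraic form: by the Rodrigues step and `mul_pearson`, the product is,
up to a nonzero factor, an element of the range minus `(1 - X²) q' P_n`, and the factor `1 - X²`
raises both exponents. -/
theorem mul_jacobi_succ_mem_range {n : ℕ} {α β : ℂ} (h : NonInt α β) {q : ℂ[X]} :
    q * jacobi (n + 1) α β ∈ LinearMap.range (pearson α β) ↔
      derivative q * jacobi n (α + 1) (β + 1) ∈ LinearMap.range (pearson (α + 1) (β + 1)) := by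
  have h0 : (-2 * ((n : ℂ) + 1)) ≠ 0 := mul_ne_zero (by norm_num) n.cast_add_one_ne_zero
  rw [jacobi_succ, mul_left_comm, ← smul_eq_C_mul, Submodule.smul_mem_iff _ (inv_ne_zero h0),
    mul_pearson, Submodule.sub_mem_iff_right _ (LinearMap.mem_range_self _ _),
    one_sub_X_sq_mul_mem_range h.left h.right]

theorem mul_jacobi_mem_range {n : ℕ} {α β : ℂ} (h : NonInt α β) {q : ℂ[X]} (hq : q.degree < n) :
    q * jacobi n α β ∈ LinearMap.range (pearson α β) := by
  induction n generalizing α β q with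
  | zero =>
    have hq0 : q = 0 := degree_eq_bot.1 (Nat.WithBot.lt_zero_iff.1 (by simpa using hq))
    simp [hq0]
  | succ n ih =>
    rw [mul_jacobi_succ_mem_range h]
    refine ih h.add_one ?_
    by_cases h0 : q.degree = 0
    · rw [eq_C_of_degree_eq_zero h0]; simp [bot_lt_iff_ne_bot]
    by_cases h1 : q = 0
    · simp [h1, bot_lt_iff_ne_bot]
    have := degree_derivative_lt (p := q) h1
    exact this.trans_le (Order.lt_succ_iff.1 hq)

/-- Differentiating `n` times leaves a nonzero constant, which is never in the range. -/
theorem mul_jacobi_notMem_range {n : ℕ} {α β : ℂ} (h : NonInt α β) {q : ℂ[X]}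
    (hq : q.degree = n) : q * jacobi n α β ∉ LinearMap.range (pearson α β) := by
  induction n generalizing α β q with
  | zero =>
    rintro ⟨g, hg⟩
    rw [eq_C_of_degree_eq_zero hq, jacobi_zero, mul_one] at hg
    rw [eq_C_of_degree_eq_zero hq, pearson_eq_C h.sum hg] at hq
    simp at hq
  | succ n ih =>
    rw [mul_jacobi_succ_mem_range h]
    refine ih h.add_one ?_
    have hq' : q.natDegree = n + 1 := natDegree_eq_of_degree_eq_some hq
    rw [degree_derivative (by omega), hq']; rfl

/-- Subtracting the multiple with the same coefficient at `X^n` leaves a remainder `r` of degree `m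
< n` if it is nonzero. Testing it against the Jacobi polynomial of degree `m` contradicts
`mul_jacobi_notMem_range`, with `r` in the role of the test polynomial. -/
theorem eq_C_mul_jacobi {n : ℕ} {α β : ℂ} (h : NonInt α β) {p : ℂ[X]} (hp : p.degree ≤ n)
    (horth : ∀ q : ℂ[X], q.degree < n → q * p ∈ LinearMap.range (pearson α β)) :
    ∃ c, p = C c * jacobi n α β := by
  have hJ := natDegree_eq_of_degree_eq_some (degree_jacobi n h)
  have hJ0 : (jacobi n α β).coeff n ≠ 0 := by
    exact coeff_ne_zero_of_eq_degree (degree_jacobi n h)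
  obtain ⟨c, hc⟩ : ∃ c, c * (jacobi n α β).coeff n = p.coeff n :=
    ⟨_, div_mul_cancel₀ (p.coeff n) hJ0⟩
  obtain ⟨r, hr⟩ : ∃ r, r = p - C c * jacobi n α β := ⟨_, rfl⟩
  suffices hr0 : r = 0 from ⟨c, sub_eq_zero.1 (hr.symm.trans hr0)⟩
  by_contra hr0
  have hrd : r.natDegree ≤ n := by
    rw [hr]
    refine (natDegree_sub_le _ _).trans (max_le (natDegree_le_of_degree_le hp) ?_)
    exact (natDegree_C_mul_le _ _).trans hJ.le
  have hrn : r.coeff n = 0 := by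
    rw [hr, coeff_sub, coeff_C_mul, hc, sub_self]
  have hm : r.natDegree < n := by
    refine lt_of_le_of_ne hrd fun h => hr0 ?_
    rw [← leadingCoeff_eq_zero, leadingCoeff, h, hrn]
  obtain ⟨m, hmd⟩ : ∃ m, m = r.natDegree := ⟨_, rfl⟩
  rw [← hmd] at hm
  have hlt : (jacobi m α β).degree < n := by
    rw [degree_jacobi m h]; exact_mod_cast hm
  have h1 : jacobi m α β * p - C c * (jacobi m α β * jacobi n α β) ∈
      LinearMap.range (pearson α β) := by
    rw [← smul_eq_C_mul]
    exact Submodule.sub_mem _ (horth _ hlt) (Submodule.smul_mem _ _ (mul_jacobi_mem_range h hlt))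
  have h2 : r * jacobi m α β = jacobi m α β * p - C c * (jacobi m α β * jacobi n α β) := by
    rw [hr]; ring
  rw [← h2] at h1
  exact mul_jacobi_notMem_range h (by rw [hmd]; exact degree_eq_natDegree hr0) h1

/-- Testing against all polynomials of degree `< n` splits, by division by `(1 + X) ^ k`. -/
theorem forall_mul_mem_range_iff {n k : ℕ} (hk : k ≤ n) {α β : ℂ} (hβ : ∀ m : ℤ, β ≠ m)
    {p : ℂ[X]} :
    (∀ q : ℂ[X], q.degree < n → q * p ∈ LinearMap.range (pearson α β)) ↔
      (∀ q : ℂ[X], q.degree < k → q * p ∈ LinearMap.range (pearson α β)) ∧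
      ∀ q : ℂ[X], q.degree < (n - k : ℕ) → q * p ∈ LinearMap.range (pearson α (β + k)) := by
  have hmonic : ((1 + X : ℂ[X]) ^ k).Monic := by
    rw [add_comm]; exact (monic_X_add_C (1 : ℂ)).pow k
  have hdeg : ((1 + X : ℂ[X]) ^ k).natDegree = k := by
    rw [add_comm, natDegree_pow, ← C_1, natDegree_X_add_C, mul_one]
  constructor
  · intro h
    refine ⟨fun q hq => h q (hq.trans_le (by exact_mod_cast hk)), fun q hq => ?_⟩
    rw [← one_add_X_pow_mul_mem_range hβ, ← mul_assoc]
    refine h _ ?_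
    by_cases hq0 : q = 0
    · simp [hq0, bot_lt_iff_ne_bot]
    rw [degree_lt_iff_coeff_zero]
    have hq' := (natDegree_lt_iff_degree_lt hq0).2 hq
    intro m hm
    refine coeff_eq_zero_of_natDegree_lt (natDegree_mul_le.trans_lt ?_)
    omega
  · rintro ⟨h1, h2⟩ q hq
    rw [← modByMonic_add_div q ((1 + X : ℂ[X]) ^ k), add_mul, mul_assoc]
    refine Submodule.add_mem _ (h1 _ ?_) ((one_add_X_pow_mul_mem_range hβ k).2 (h2 _ ?_))
    · refine (degree_modByMonic_lt q hmonic).trans_eq ?_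
      rw [degree_eq_natDegree hmonic.ne_zero, hdeg]
    · by_cases h0 : q /ₘ ((1 + X : ℂ[X]) ^ k) = 0
      · simp [h0, bot_lt_iff_ne_bot]
      rw [← natDegree_lt_iff_degree_lt h0, natDegree_divByMonic _ hmonic, hdeg]
      have hq0 : q ≠ 0 := by rintro rfl; simp at h0
      have hle : k ≤ q.natDegree := by
        by_contra hlt
        refine h0 ((divByMonic_eq_zero_iff hmonic).2 ?_)
        rw [degree_eq_natDegree hmonic.ne_zero, hdeg]
        exact (natDegree_lt_iff_degree_lt hq0).1 (not_le.1 hlt)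
      have := (natDegree_lt_iff_degree_lt hq0).2 hq
      omega

/-! ### Functionals annihilating the range of the Pearson operator -/

/-- `H f a` says that a linear functional, defined on a space of polynomials, has at `f` the
value `a`; it annihilates `pearson α β g` for `g` of degree less than `N`, and is nonzero on
polynomials of degree at most `N`. -/
structure PearsonFunctional (α β : ℂ) (N : ℕ) (H : ℂ[X] → ℂ → Prop) : Prop where
  add : ∀ {f g a b}, H f a → H g b → H (f + g) (a + b)
  const_mul : ∀ {f a} (c : ℂ), H f a → H (C c * f) (c * a)
  unique : ∀ {f a b}, H f a → H f b → a = b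
  pearson : ∀ g : ℂ[X], g.natDegree < N → H (pearson α β g) 0
  nontrivial : ∃ f a, f.natDegree ≤ N ∧ a ≠ 0 ∧ H f a

namespace PearsonFunctional

variable {α β : ℂ} {N : ℕ} {H : ℂ[X] → ℂ → Prop}

theorem zero (hH : PearsonFunctional α β N H) : H 0 0 := by
  obtain ⟨f, a, -, -, hf⟩ := hH.nontrivial
  simpa using hH.const_mul 0 hf

theorem pearson_of_natDegree_le (hH : PearsonFunctional α β N H) (hαβ : ∀ m : ℤ, α + β ≠ m)
    {g : ℂ[X]} (hg : (JacobiOrth.pearson α β g).natDegree ≤ N) :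
    H (JacobiOrth.pearson α β g) 0 := by
  by_cases h0 : g = 0
  · simpa [h0] using hH.zero
  · rw [natDegree_pearson hαβ h0] at hg
    exact hH.pearson g hg

theorem natDegree_le_of_eq_C_add {f g : ℂ[X]} {c : ℂ} (hf : f.natDegree ≤ N)
    (h : f = C c + g) : g.natDegree ≤ N := by
  rw [show g = f - C c by rw [h]; ring]
  exact (natDegree_sub_le _ _).trans (by simpa using hf)

/-- If `f = c + T g`, the value at `f` is the value at `c`; a nonzero value anywhere forces a
nonzero value at `1`. -/
theorem exists_one (hH : PearsonFunctional α β N H) (hαβ : ∀ m : ℤ, α + β ≠ m) :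
    ∃ a ≠ 0, H 1 a := by
  obtain ⟨f, a, hfN, ha, hf⟩ := hH.nontrivial
  obtain ⟨c, g, hfg⟩ := exists_eq_C_add_pearson hαβ f
  have h0 := hH.pearson_of_natDegree_le hαβ (natDegree_le_of_eq_C_add hfN hfg)
  have hc : H (C c) a := by
    have := hH.add hf (hH.const_mul (-1) h0)
    rw [hfg] at this
    simpa using this
  have hc0 : c ≠ 0 := by
    rintro rfl
    exact ha (hH.unique (by simpa using hc) hH.zero)
  refine ⟨c⁻¹ * a, mul_ne_zero (inv_ne_zero hc0) ha, ?_⟩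
  have := hH.const_mul c⁻¹ hc
  rwa [← C_mul, inv_mul_cancel₀ hc0, C_1] at this

/-- The value at `f = c + T g` is `c` times the nonzero value at `1`, and `c = 0` exactly when `f`
is in the range. The degree bound passes from `f` to `T g`, so only values at polynomials of degree
at most `N` are used. -/
theorem exists_value (hH : PearsonFunctional α β N H) (hαβ : ∀ m : ℤ, α + β ≠ m) {f : ℂ[X]}
    (hf : f.natDegree ≤ N) :
    ∃ a, H f a ∧ (a = 0 ↔ f ∈ LinearMap.range (JacobiOrth.pearson α β)) := by
  obtain ⟨a, ha, h1⟩ := hH.exists_one hαβ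
  obtain ⟨c, g, hfg⟩ := exists_eq_C_add_pearson hαβ f
  have h0 := hH.pearson_of_natDegree_le hαβ (natDegree_le_of_eq_C_add hf hfg)
  refine ⟨c * a, ?_, ?_⟩
  · have := hH.add (hH.const_mul c h1) h0
    rwa [mul_one, ← hfg, add_zero] at this
  · rw [mul_eq_zero, or_iff_left ha]
    constructor
    · rintro rfl
      exact ⟨g, by rw [hfg]; simp⟩
    · rintro ⟨g', hg'⟩
      refine pearson_eq_C hαβ (g := g' - g) ?_
      rw [map_sub, hg', hfg]; ring

theorem eq_zero_iff (hH : PearsonFunctional α β N H) (hαβ : ∀ m : ℤ, α + β ≠ m) {f : ℂ[X]}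
    (hf : f.natDegree ≤ N) : H f 0 ↔ f ∈ LinearMap.range (JacobiOrth.pearson α β) := by
  obtain ⟨a, ha, h⟩ := hH.exists_value hαβ hf
  rw [← h]
  exact ⟨fun h0 => hH.unique ha h0, fun h0 => h0 ▸ ha⟩

end PearsonFunctional

/-! ### Integrals along curves -/

theorem eventually_prod_mem_Ioo : ∀ᶠ e : ℝ × ℝ in 𝓝[>] 0 ×ˢ 𝓝[<] 1,
    e.1 ∈ Ioo (0 : ℝ) 1 ∧ e.2 ∈ Ioo (0 : ℝ) 1 :=
  prod_mem_prod (Ioo_mem_nhdsGT zero_lt_one) (Ioo_mem_nhdsLT zero_lt_one)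

theorem hasCurveIntegral_congr {γ f g : ℝ → ℂ} {L : ℂ} (h : HasCurveIntegral γ f L)
    (hfg : ∀ s ∈ Ioo (0 : ℝ) 1, f s = g s) : HasCurveIntegral γ g L := by
  refine ⟨h.1.congr ?_, h.2.congr' ?_⟩
  · filter_upwards [ae_restrict_mem measurableSet_Ioo] with s hs
    rw [hfg s hs]
  · filter_upwards [eventually_prod_mem_Ioo] with e he
    refine intervalIntegral.integral_congr fun s hs => ?_
    simp only [hfg s (ordConnected_Ioo.uIcc_subset he.1 he.2 hs)]

theorem HasCurveIntegral.unique {γ f : ℝ → ℂ} {a b : ℂ} (ha : HasCurveIntegral γ f a)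
    (hb : HasCurveIntegral γ f b) : a = b :=
  tendsto_nhds_unique ha.2 hb.2

theorem HasCurveIntegral.add {γ f g : ℝ → ℂ} {a b : ℂ} (ha : HasCurveIntegral γ f a)
    (hb : HasCurveIntegral γ g b) : HasCurveIntegral γ (fun s => f s + g s) (a + b) := by
  refine ⟨(ha.1.add hb.1).congr (.of_forall fun s => by simp [add_mul]),
    (ha.2.add hb.2).congr' ?_⟩
  filter_upwards [eventually_prod_mem_Ioo] with e he
  have hsub := ordConnected_Ioo.uIcc_subset he.1 he.2
  rw [← intervalIntegral.integral_add]
  · simp only [add_mul]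
  · exact (ha.1.integrableOn_compact_subset hsub isCompact_uIcc).intervalIntegrable
  · exact (hb.1.integrableOn_compact_subset hsub isCompact_uIcc).intervalIntegrable

theorem HasCurveIntegral.const_mul {γ f : ℝ → ℂ} {a : ℂ} (c : ℂ) (ha : HasCurveIntegral γ f a) :
    HasCurveIntegral γ (fun s => c * f s) (c * a) := by
  refine ⟨(ha.1.smul c).congr (.of_forall fun s => by simp [mul_assoc]),
    (ha.2.const_mul c).congr fun e => ?_⟩
  simp only [mul_assoc, intervalIntegral.integral_const_mul]

/-- The fundamental theorem of calculus on compact subintervals, in the version that tolerates a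
countable set without derivative, followed by passage to the limit at both ends. -/
theorem hasCurveIntegral_of_hasDerivAt {γ : ℝ → ℂ} (hγ : IsCurve γ) {D : Set ℂ}
    (hD : ∀ s ∈ Ioo (0 : ℝ) 1, γ s ∈ D) {F f : ℂ → ℂ} (hF : ∀ z ∈ D, HasDerivAt F (f z) z)
    (hf : ContinuousOn f D) {A B : ℂ} (hA : Tendsto (fun s => F (γ s)) (𝓝[>] 0) (𝓝 A))
    (hB : Tendsto (fun s => F (γ s)) (𝓝[<] 1) (𝓝 B)) :
    HasCurveIntegral γ (fun s => f (γ s)) (B - A) := by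
  have hloc : LocallyIntegrableOn (fun s => f (γ s) * deriv γ s) (Ioo 0 1) :=
    hγ.locallyIntegrable.continuousOn_mul (hf.comp hγ.continuousOn hD) isOpen_Ioo.isLocallyClosed
  obtain ⟨S, hS, hdiff⟩ := hγ.differentiable
  refine ⟨hloc, ((hB.comp tendsto_snd).sub (hA.comp tendsto_fst)).congr' ?_⟩
  filter_upwards [eventually_prod_mem_Ioo] with e he
  have hsub := ordConnected_Ioo.uIcc_subset he.1 he.2
  refine (integral_eq_of_hasDerivAt_off_countable (fun s => F (γ s)) _ hS ?_ (fun s hs => ?_)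
    (hloc.integrableOn_compact_subset hsub isCompact_uIcc).intervalIntegrable).symm
  · intro s hs
    exact ((hF _ (hD s (hsub hs))).continuousAt.comp_continuousWithinAt
      (hγ.continuousOn s (hsub hs))).mono hsub
  · have hs' : s ∈ Ioo (0 : ℝ) 1 := hsub (Ioo_subset_Icc_self hs.1)
    exact (hF _ (hD s hs')).comp_of_eq s (hdiff s ⟨hs', hs.2⟩).hasDerivAt rfl |>.congr_deriv
      (by simp)

/-! ### Branches of the weight -/

/-- Two choices of logarithms differ by multiples of `2πi`, so the quotient of two branches takes
values in a countable set. Being continuous on a connected set, it is constant. -/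
theorem IsWeightBranch.exists_eq_mul {α β : ℝ} {γ W A B : ℝ → ℂ} {I : Set ℝ}
    (hI : IsPreconnected I) (hW : IsWeightBranch α β γ I W) (hA : ContinuousOn A I)
    (hB : ContinuousOn B I) (hexpA : ∀ s ∈ I, Complex.exp (A s) = 1 - γ s)
    (hexpB : ∀ s ∈ I, Complex.exp (B s) = γ s + 1) :
    ∃ c ≠ 0, ∀ s ∈ I, W s = c * Complex.exp (α * A s + β * B s) := by
  rcases I.eq_empty_or_nonempty with rfl | ⟨s₀, hs₀⟩
  · exact ⟨1, one_ne_zero, by simp⟩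
  set E : ℝ → ℂ := fun s => Complex.exp (α * A s + β * B s) with hE
  have hE0 : ∀ s, E s ≠ 0 := fun s => Complex.exp_ne_zero _
  set K : Set ℂ := range fun p : ℤ × ℤ =>
    Complex.exp (α * (p.1 * (2 * Real.pi * Complex.I)) + β * (p.2 * (2 * Real.pi * Complex.I)))
  have hmaps : MapsTo (fun s => W s / E s) I K := by
    intro s hs
    obtain ⟨a, b, ha, hb, hw⟩ := hW.2 s hs
    obtain ⟨m, hm⟩ := Complex.exp_eq_exp_iff_exists_int.1 (ha.trans (hexpA s hs).symm)
    obtain ⟨l, hl⟩ := Complex.exp_eq_exp_iff_exists_int.1 (hb.trans (hexpB s hs).symm)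
    refine ⟨(m, l), ?_⟩
    simp only [hw, hE, hm, hl, ← Complex.exp_sub]
    congr 1; ring
  have hcont : ContinuousOn (fun s => W s / E s) I :=
    hW.1.div (by fun_prop) fun s _ => hE0 s
  have hsub : ((fun s => W s / E s) '' I).Subsingleton :=
    (countable_range _ : K.Countable).isTotallyDisconnected _ hmaps.image_subset (hI.image _ hcont)
  refine ⟨W s₀ / E s₀, ?_, fun s hs => ?_⟩
  · obtain ⟨p, hp⟩ := hmaps hs₀
    simp only at hp
    rw [← hp]
    exact Complex.exp_ne_zero _
  · rw [← hsub (mem_image_of_mem _ hs) (mem_image_of_mem _ hs₀), div_mul_cancel₀ _ (hE0 s)]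

/-- `A` and `B` are holomorphic branches of `log (1 - z)` and `log (z + 1)` on `D`. -/
structure LogPair (D : Set ℂ) (A B : ℂ → ℂ) : Prop where
  exp_left : ∀ z ∈ D, Complex.exp (A z) = 1 - z
  exp_right : ∀ z ∈ D, Complex.exp (B z) = z + 1
  deriv_left : ∀ z ∈ D, HasDerivAt A (-(1 - z)⁻¹) z
  deriv_right : ∀ z ∈ D, HasDerivAt B ((z + 1)⁻¹) z

namespace LogPair

variable {D : Set ℂ} {A B : ℂ → ℂ}

theorem one_sub_ne_zero (h : LogPair D A B) {z : ℂ} (hz : z ∈ D) : 1 - z ≠ 0 :=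
  h.exp_left z hz ▸ Complex.exp_ne_zero _

theorem add_one_ne_zero (h : LogPair D A B) {z : ℂ} (hz : z ∈ D) : z + 1 ≠ 0 :=
  h.exp_right z hz ▸ Complex.exp_ne_zero _

theorem hasDerivAt_exp (h : LogPair D A B) (α β : ℂ) {z : ℂ} (hz : z ∈ D) :
    HasDerivAt (fun z => Complex.exp (α * A z + β * B z))
      ((-α * (1 - z)⁻¹ + β * (z + 1)⁻¹) * Complex.exp (α * A z + β * B z)) z := by
  refine (((h.deriv_left z hz).const_mul α).add ((h.deriv_right z hz).const_mul β)).cexp.congr_deriv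
    ?_
  simp only [Pi.add_apply]
  ring

theorem continuousOn_exp (h : LogPair D A B) (α β : ℂ) :
    ContinuousOn (fun z => Complex.exp (α * A z + β * B z)) D := fun _ hz =>
  (h.hasDerivAt_exp α β hz).continuousAt.continuousWithinAt

theorem hasDerivAt_pearson (h : LogPair D A B) (α β : ℂ) (g : ℂ[X]) {z : ℂ} (hz : z ∈ D) :
    HasDerivAt (fun z => (1 - z ^ 2) * g.eval z * Complex.exp (α * A z + β * B z))
      ((pearson α β g).eval z * Complex.exp (α * A z + β * B z)) z := by
  have h1 := h.one_sub_ne_zero hz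
  have h2 := h.add_one_ne_zero hz
  have h3 : HasDerivAt (fun z : ℂ => 1 - z ^ 2) (-(2 * z)) z := by
    simpa using (hasDerivAt_pow 2 z).const_sub 1
  refine ((h3.mul (g.hasDerivAt z)).mul (h.hasDerivAt_exp α β hz)).congr_deriv ?_
  rw [eval_pearson]
  simp only [Pi.mul_apply]
  field_simp
  ring

/-- For real exponents the modulus of the weight is single-valued, so boundary terms can be
estimated without regard to the branch. -/
theorem norm_exp (h : LogPair D A B) (α β : ℝ) {z : ℂ} (hz : z ∈ D) :
    ‖Complex.exp (α * A z + β * B z)‖ = ‖1 - z‖ ^ α * ‖z + 1‖ ^ β := by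
  rw [Complex.norm_exp, ← h.exp_left z hz, ← h.exp_right z hz, Complex.norm_exp, Complex.norm_exp,
    ← Real.exp_mul, ← Real.exp_mul, ← Real.exp_add]
  congr 1
  simp; ring

theorem exp_add_natCast (h : LogPair D A B) (α β : ℂ) (j k : ℕ) {z : ℂ} (hz : z ∈ D) :
    Complex.exp ((α + j) * A z + (β + k) * B z) =
      (1 - z) ^ j * (z + 1) ^ k * Complex.exp (α * A z + β * B z) := by
  rw [← h.exp_left z hz, ← h.exp_right z hz, ← Complex.exp_nat_mul, ← Complex.exp_nat_mul,
    ← Complex.exp_add, ← Complex.exp_add]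
  congr 1; ring

theorem exists_eq_mul (h : LogPair D A B) {α β : ℝ} {γ W : ℝ → ℂ} {I : Set ℝ}
    (hI : IsPreconnected I) (hγ : ContinuousOn γ I) (hD : ∀ s ∈ I, γ s ∈ D)
    (hW : IsWeightBranch α β γ I W) :
    ∃ c ≠ 0, ∀ s ∈ I, W s = c * Complex.exp (α * A (γ s) + β * B (γ s)) :=
  hW.exists_eq_mul hI
    (fun s hs => (h.deriv_left _ (hD s hs)).continuousAt.comp_continuousWithinAt (hγ s hs))
    (fun s hs => (h.deriv_right _ (hD s hs)).continuousAt.comp_continuousWithinAt (hγ s hs))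
    (fun s hs => h.exp_left _ (hD s hs)) (fun s hs => h.exp_right _ (hD s hs))

/-- The integrals along a curve form a functional annihilating the range of the Pearson
operator, as soon as the boundary terms vanish. -/
theorem pearsonFunctional (h : LogPair D A B) {α β : ℝ} {γ W : ℝ → ℂ} (hγ : IsCurve γ)
    (hD : ∀ s ∈ Ioo (0 : ℝ) 1, γ s ∈ D) {N : ℕ} {c : ℂ}
    (hc : ∀ s ∈ Ioo (0 : ℝ) 1, W s = c * Complex.exp (α * A (γ s) + β * B (γ s)))
    (hstart : ∀ g : ℂ[X], g.natDegree < N → Tendsto (fun s => (1 - γ s ^ 2) * g.eval (γ s) *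
      Complex.exp (α * A (γ s) + β * B (γ s))) (𝓝[>] 0) (𝓝 0))
    (hfinish : ∀ g : ℂ[X], g.natDegree < N → Tendsto (fun s => (1 - γ s ^ 2) * g.eval (γ s) *
      Complex.exp (α * A (γ s) + β * B (γ s))) (𝓝[<] 1) (𝓝 0))
    (hne : ∃ (f : ℂ[X]) (a : ℂ), f.natDegree ≤ N ∧ a ≠ 0 ∧
      HasCurveIntegral γ (fun s => f.eval (γ s) * W s) a) :
    PearsonFunctional α β N (fun f a => HasCurveIntegral γ (fun s => f.eval (γ s) * W s) a) where
  add h1 h2 := by simpa only [eval_add, add_mul] using h1.add h2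
  const_mul c h1 := by simpa only [eval_mul, eval_C, mul_assoc] using h1.const_mul c
  unique := HasCurveIntegral.unique
  pearson g hg := by
    have := (hasCurveIntegral_of_hasDerivAt hγ hD (fun z hz => h.hasDerivAt_pearson α β g hz)
      ((pearson α β g).continuous.continuousOn.mul (h.continuousOn_exp α β)) (hstart g hg)
      (hfinish g hg)).const_mul c
    rw [sub_zero, mul_zero] at this
    exact hasCurveIntegral_congr this fun s hs => by rw [hc s hs]; ring
  nontrivial := hne

end LogPair

/-! ### A primitive of the weight on the plane cut along `[-1, ∞)` -/

/-- The plane cut along `[x, ∞)`. -/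
def cutPlane (x : ℝ) : Set ℂ := {z | ¬ (z.im = 0 ∧ x ≤ z.re)}

theorem isOpen_cutPlane (x : ℝ) : IsOpen (cutPlane x) := by
  have h : IsClosed {z : ℂ | z.im = 0 ∧ x ≤ z.re} :=
    (isClosed_eq Complex.continuous_im continuous_const).inter
      (isClosed_le continuous_const Complex.continuous_re)
  exact h.isOpen_compl

theorem sub_mul_mem_slitPlane {v : ℂ} (hv : v ∈ cutPlane 2) {s : ℝ} (h0 : 0 ≤ s) (h1 : s ≤ 1) :
    2 - s * v ∈ Complex.slitPlane := by
  rw [Complex.mem_slitPlane_iff]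
  by_contra! h
  obtain ⟨h2, h3⟩ := h
  simp at h2 h3
  rcases h3 with rfl | h3
  · norm_num at h2
  · refine hv ⟨h3, ?_⟩
    by_contra! hlt
    rcases h0.eq_or_lt with rfl | h0
    · norm_num at h2
    · nlinarith

theorem two_sub_mul_mem_slitPlane {s : ℝ} (h1 : s < 1) :
    (2 - s * 2 : ℂ) ∈ Complex.slitPlane := by
  rw [Complex.mem_slitPlane_iff]
  left; simp; linarith

theorem continuousOn_two_sub_mul_cpow {v : ℂ} (hv : v ∈ cutPlane 2) (a : ℂ) :
    ContinuousOn (fun s : ℝ => (2 - s * v) ^ a) (Icc 0 1) := by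
  intro s hs
  refine ContinuousWithinAt.cpow ?_ continuousWithinAt_const (sub_mul_mem_slitPlane hv hs.1 hs.2)
  fun_prop

theorem norm_two_sub_mul_le {v : ℂ} {s : ℝ} (h0 : 0 ≤ s) (h1 : s ≤ 1) :
    ‖2 - s * v‖ ≤ 2 + ‖v‖ := by
  refine (norm_sub_le _ _).trans ?_
  rw [norm_mul, Complex.norm_real, Real.norm_of_nonneg h0]
  simpa using mul_le_of_le_one_left (norm_nonneg v) h1

theorem intervalIntegrable_rpow_ofReal {b : ℝ} (hb : -1 < b) :
    IntervalIntegrable (fun s : ℝ => ((s ^ b : ℝ) : ℂ)) volume 0 1 :=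
  have h := intervalIntegral.intervalIntegrable_rpow' hb (a := 0) (b := 1)
  ⟨h.1.ofReal, h.2.ofReal⟩

/-- The integral `∫₀¹ sᵇ (2 - s v)ᵃ ds`. -/
def eulerIntegral (a b : ℝ) (v : ℂ) : ℂ := ∫ s in (0 : ℝ)..1, ((s ^ b : ℝ) : ℂ) * (2 - s * v) ^ (a : ℂ)

theorem aestronglyMeasurable_rpow_mul {b : ℝ} (hb : -1 < b) {g : ℝ → ℂ}
    (hg : ContinuousOn g (Icc 0 1)) :
    AEStronglyMeasurable (fun s : ℝ => ((s ^ b : ℝ) : ℂ) * g s) (volume.restrict (uIoc 0 1)) :=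
  (intervalIntegrable_iff.1 ((intervalIntegrable_rpow_ofReal hb).mul_continuousOn
    (by rwa [uIcc_of_le zero_le_one]))).aestronglyMeasurable

/-- Differentiation under the integral sign: `1 < a` keeps `(2 - s w)^(a - 1)` bounded for `w` near
`v`, so a constant times `s^b` dominates. -/
theorem hasDerivAt_eulerIntegral {a b : ℝ} (ha : 1 < a) (hb : -1 < b) {v : ℂ}
    (hv : v ∈ cutPlane 2) :
    IntervalIntegrable (fun s : ℝ => ((s ^ b : ℝ) : ℂ) * (a * (2 - s * v) ^ (a - 1 : ℂ) * -s))
      volume 0 1 ∧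
    HasDerivAt (eulerIntegral a b)
      (∫ s in (0 : ℝ)..1, ((s ^ b : ℝ) : ℂ) * (a * (2 - s * v) ^ (a - 1 : ℂ) * -s)) v := by
  have hS : cutPlane 2 ∩ Metric.ball v 1 ∈ 𝓝 v :=
    inter_mem ((isOpen_cutPlane 2).mem_nhds hv) (Metric.ball_mem_nhds v one_pos)
  have hcont' : ContinuousOn (fun s : ℝ => (a * (2 - s * v) ^ (a - 1 : ℂ) * -s : ℂ)) (Icc 0 1) :=
    (continuousOn_const.mul (continuousOn_two_sub_mul_cpow hv _)).mul (by fun_prop)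
  refine intervalIntegral.hasDerivAt_integral_of_dominated_loc_of_deriv_le (μ := volume)
    (F := fun v s => ((s ^ b : ℝ) : ℂ) * (2 - s * v) ^ (a : ℂ))
    (F' := fun v s => ((s ^ b : ℝ) : ℂ) * (a * (2 - s * v) ^ (a - 1 : ℂ) * -s))
    (bound := fun s => s ^ b * (a * (2 + (‖v‖ + 1)) ^ (a - 1))) hS ?_ ?_ ?_ ?_ ?_ ?_
  · filter_upwards [hS] with w hw
    exact aestronglyMeasurable_rpow_mul hb (continuousOn_two_sub_mul_cpow hw.1 _)
  · refine (intervalIntegrable_rpow_ofReal hb).mul_continuousOn ?_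
    rw [uIcc_of_le zero_le_one]
    exact continuousOn_two_sub_mul_cpow hv _
  · exact aestronglyMeasurable_rpow_mul hb hcont'
  · refine .of_forall fun s hs w hw => ?_
    rw [uIoc_of_le zero_le_one] at hs
    have hw' : ‖w‖ ≤ ‖v‖ + 1 := by
      have := norm_le_norm_add_norm_sub' w v
      have h2 := hw.2
      rw [Metric.mem_ball, dist_eq_norm] at h2
      linarith
    rw [norm_mul, Complex.norm_real, Real.norm_of_nonneg (Real.rpow_nonneg hs.1.le _)]
    refine mul_le_mul_of_nonneg_left ?_ (Real.rpow_nonneg hs.1.le _)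
    have e : ((a : ℂ) - 1) = ((a - 1 : ℝ) : ℂ) := by push_cast; rfl
    rw [norm_mul, norm_mul, norm_neg, Complex.norm_real, Complex.norm_real,
      Real.norm_of_nonneg (by linarith : 0 ≤ a), Real.norm_of_nonneg hs.1.le, e,
      Complex.norm_cpow_real]
    refine (mul_le_of_le_one_right (by positivity) hs.2).trans ?_
    have h3 : ‖2 - s * w‖ ≤ 2 + (‖v‖ + 1) :=
      (norm_two_sub_mul_le hs.1.le hs.2).trans (by linarith)
    have h4 := Real.rpow_le_rpow (norm_nonneg _) h3 (by linarith : 0 ≤ a - 1)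
    exact mul_le_mul_of_nonneg_left h4 (by linarith)
  · exact (intervalIntegral.intervalIntegrable_rpow' hb).mul_const _
  · refine .of_forall fun s hs w hw => ?_
    rw [uIoc_of_le zero_le_one] at hs
    refine HasDerivAt.const_mul _ ?_
    have h1 : HasDerivAt (fun w : ℂ => 2 - s * w) (-s) w := by
      simpa using ((hasDerivAt_id w).const_mul (s : ℂ)).const_sub 2
    exact h1.cpow_const (sub_mul_mem_slitPlane hw.1 hs.1.le hs.2)

/-- Integrate the derivative of `s^(b + 1) (2 - s v)^a` over `[0, 1]`. The identity says that `v^(b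
+ 1)` times the Euler integral is a primitive of `v^b (2 - v)^a`, stated without a branch of `v^b`.
-/
theorem eulerIntegral_add_mul_deriv {a b : ℝ} (ha : 1 < a) (hb : -1 < b) {v : ℂ}
    (hv : v ∈ cutPlane 2) :
    (b + 1) * eulerIntegral a b v +
      v * ∫ s in (0 : ℝ)..1, ((s ^ b : ℝ) : ℂ) * (a * (2 - s * v) ^ (a - 1 : ℂ) * -s) =
      (2 - v) ^ (a : ℂ) := by
  have h1 : IntervalIntegrable (fun s : ℝ => ((s ^ b : ℝ) : ℂ) * (2 - s * v) ^ (a : ℂ))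
      volume 0 1 := by
    refine (intervalIntegrable_rpow_ofReal hb).mul_continuousOn ?_
    rw [uIcc_of_le zero_le_one]
    exact continuousOn_two_sub_mul_cpow hv _
  have h2 := (hasDerivAt_eulerIntegral ha hb hv).1
  have hb0 : b + 1 ≠ 0 := by linarith
  rw [eulerIntegral, ← intervalIntegral.integral_const_mul, ← intervalIntegral.integral_const_mul,
    ← intervalIntegral.integral_add (h1.const_mul _) (h2.const_mul _),
    intervalIntegral.integral_eq_sub_of_hasDerivAt_of_le zero_le_one
      (f := fun s : ℝ => ((s ^ (b + 1) : ℝ) : ℂ) * (2 - s * v) ^ (a : ℂ))]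
  · simp [Real.zero_rpow hb0]
  · refine ContinuousOn.mul ?_ (continuousOn_two_sub_mul_cpow hv _)
    exact (Complex.continuous_ofReal.comp (Real.continuous_rpow_const (by linarith))).continuousOn
  · intro s hs
    have h3 : HasDerivAt (fun s : ℝ => ((s ^ (b + 1) : ℝ) : ℂ)) (((b + 1) * s ^ b : ℝ) : ℂ) s := by
      have := (Real.hasDerivAt_rpow_const (x := s) (p := b + 1) (Or.inl hs.1.ne')).ofReal_comp
      simpa using this
    have h4 : HasDerivAt (fun w : ℂ => 2 - w * v) (-v) (s : ℂ) := by
      simpa using ((hasDerivAt_id (s : ℂ)).mul_const v).const_sub 2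
    have h5 := (h4.cpow_const (c := a) (sub_mul_mem_slitPlane hv hs.1.le hs.2.le)).comp_ofReal
    refine (h3.mul h5).congr_deriv ?_
    rw [Real.rpow_add_one hs.1.ne']
    push_cast
    ring
  · exact (h1.const_mul _).add (h2.const_mul _)

theorem tendsto_eulerIntegral {a b : ℝ} (ha : 1 < a) (hb : -1 < b) :
    Tendsto (eulerIntegral a b) (𝓝[cutPlane 2] 2) (𝓝 (eulerIntegral a b 2)) := by
  refine intervalIntegral.tendsto_integral_filter_of_dominated_convergence
    (fun s => s ^ b * (2 + (2 + 1)) ^ a) ?_ ?_ ?_ ?_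
  · filter_upwards [self_mem_nhdsWithin] with v hv
    exact aestronglyMeasurable_rpow_mul hb (continuousOn_two_sub_mul_cpow hv _)
  · have : ∀ᶠ v : ℂ in 𝓝[cutPlane 2] 2, v ∈ Metric.ball (2 : ℂ) 1 :=
      nhdsWithin_le_nhds (Metric.ball_mem_nhds _ one_pos)
    filter_upwards [this] with v hv
    refine .of_forall fun s hs => ?_
    rw [uIoc_of_le zero_le_one] at hs
    have hv' : ‖v‖ ≤ 2 + 1 := by
      have := norm_le_norm_add_norm_sub' v 2
      rw [Metric.mem_ball, dist_eq_norm] at hv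
      norm_num at this
      linarith
    rw [norm_mul, Complex.norm_real, Real.norm_of_nonneg (Real.rpow_nonneg hs.1.le _),
      Complex.norm_cpow_real]
    have := Real.rpow_nonneg hs.1.le b
    gcongr
    exact (norm_two_sub_mul_le hs.1.le hs.2).trans (by linarith)
  · exact (intervalIntegral.intervalIntegrable_rpow' hb).mul_const _
  -- At `v = 2` the base `2 - s v` meets the branch cut only at its tip, for `s = 1`; this null set
  -- is discarded.
  · have hne : ∀ᵐ s : ℝ, s ≠ 1 := by simp [ae_iff]
    filter_upwards [hne] with s hs1 hs
    rw [uIoc_of_le zero_le_one] at hs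
    refine Tendsto.const_mul _ ?_
    refine Tendsto.mono_left ?_ nhdsWithin_le_nhds
    have : ContinuousAt (fun v : ℂ => (2 - s * v) ^ (a : ℂ)) 2 :=
      ContinuousAt.cpow (by fun_prop) continuousAt_const
        (two_sub_mul_mem_slitPlane (lt_of_le_of_ne hs.2 hs1))
    exact this

theorem eulerIntegral_two_ne_zero {a b : ℝ} (ha : 1 < a) (hb : -1 < b) :
    eulerIntegral a b 2 ≠ 0 := by
  have h : eulerIntegral a b 2 = ((∫ s in (0 : ℝ)..1, s ^ b * (2 - s * 2) ^ a : ℝ) : ℂ) := by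
    rw [eulerIntegral, ← intervalIntegral.integral_ofReal]
    refine intervalIntegral.integral_congr fun s hs => ?_
    rw [uIcc_of_le zero_le_one] at hs
    rw [Complex.ofReal_mul, Complex.ofReal_cpow (by linarith [hs.2] : (0 : ℝ) ≤ 2 - s * 2)]
    push_cast; rfl
  rw [h, Complex.ofReal_ne_zero]
  refine (intervalIntegral.intervalIntegral_pos_of_pos_on ?_ (fun s hs => ?_) zero_lt_one).ne'
  · refine (intervalIntegral.intervalIntegrable_rpow' hb).mul_continuousOn ?_
    exact (Continuous.rpow_const (by fun_prop) fun _ => Or.inr (by linarith)).continuousOn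
  · exact mul_pos (Real.rpow_pos_of_pos hs.1 _) (Real.rpow_pos_of_pos (by linarith [hs.2]) _)

theorem one_sub_mem_slitPlane {z : ℂ} {x : ℝ} (hz : z ∈ cutPlane x) (hx : x ≤ 1) :
    1 - z ∈ Complex.slitPlane := by
  rw [Complex.mem_slitPlane_iff]
  by_contra! h
  simp at h
  exact hz ⟨h.2, by linarith⟩

theorem neg_one_sub_mem_slitPlane {z : ℂ} (hz : z ∈ cutPlane (-1)) :
    -1 - z ∈ Complex.slitPlane := by
  rw [Complex.mem_slitPlane_iff]
  by_contra! h
  simp at h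
  exact hz ⟨h.2, by linarith⟩

/-- The primitive is the integral of the weight along the segment from `-1` to `z`. The substitution
`t = -1 + s (1 + z)` makes it `-(-1 - z)^(b + 1)` times an Euler integral that has a nonzero limit
at `z = 1`, so all the jump across the cut sits in the power. -/
theorem exists_primitive {a b : ℝ} (ha : 1 < a) (hb : -1 < b) (hbint : ∀ m : ℤ, b ≠ m) :
    ∃ (F : ℂ → ℂ) (l₁ l₂ : ℂ), l₁ ≠ l₂ ∧
      (∀ z ∈ cutPlane (-1),
        HasDerivAt F (Complex.exp (a * Complex.log (1 - z) + b * Complex.log (-1 - z))) z) ∧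
      Tendsto F (𝓝[{z | z.im < 0}] 1) (𝓝 l₁) ∧ Tendsto F (𝓝[{z | 0 < z.im}] 1) (𝓝 l₂) := by
  set F : ℂ → ℂ := fun z =>
    -Complex.exp ((b + 1) * Complex.log (-1 - z)) * eulerIntegral a b (1 + z) with hF
  have hG2 := eulerIntegral_two_ne_zero ha hb
  have hlim : ∀ (S : Set ℂ) (l : ℂ), (∀ z ∈ S, z.im ≠ 0) →
      Tendsto (fun z : ℂ => Complex.log (-1 - z)) (𝓝[S] 1) (𝓝 l) →
      Tendsto F (𝓝[S] 1) (𝓝 (-Complex.exp ((b + 1) * l) * eulerIntegral a b 2)) := by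
    intro S l hS hl
    refine (hl.const_mul _).cexp.neg.mul ((tendsto_eulerIntegral ha hb).comp ?_)
    refine tendsto_nhdsWithin_iff.2 ⟨?_, ?_⟩
    · have : Tendsto (fun z : ℂ => 1 + z) (𝓝 1) (𝓝 (1 + 1)) := Continuous.tendsto (by fun_prop) 1
      rw [one_add_one_eq_two] at this
      exact this.mono_left nhdsWithin_le_nhds
    · filter_upwards [self_mem_nhdsWithin] with z hz h
      exact hS z hz (by simpa using h.1)
  have hnhds : ∀ S : Set ℂ, Tendsto (fun z : ℂ => -1 - z) (𝓝[S] 1) (𝓝 (-2)) := fun S => by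
    have : Tendsto (fun z : ℂ => -1 - z) (𝓝 1) (𝓝 (-1 - 1)) := Continuous.tendsto (by fun_prop) 1
    rw [show (-1 - 1 : ℂ) = -2 by norm_num] at this
    exact this.mono_left nhdsWithin_le_nhds
  refine ⟨F, _, _, ?_, ?_, hlim _ (Real.log ‖(-2 : ℂ)‖ + Real.pi * Complex.I) (fun z hz => ne_of_lt hz) ?_,
    hlim _ (Real.log ‖(-2 : ℂ)‖ - Real.pi * Complex.I) (fun z hz => ne_of_gt hz) ?_⟩
  -- The limits from below and above are in the ratio `exp (2πi (b + 1))`, which is `1` only for an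
  -- integer `b`.
  · intro h
    rw [mul_left_inj' hG2, neg_inj, Complex.exp_eq_exp_iff_exists_int] at h
    obtain ⟨m, hm⟩ := h
    have h1 : (2 * Real.pi * Complex.I) * (b + 1 - m : ℂ) = 0 := by linear_combination hm
    rw [mul_eq_zero, or_iff_right Complex.two_pi_I_ne_zero] at h1
    have h2 : (b : ℂ) = ((m - 1 : ℤ) : ℂ) := by push_cast; linear_combination h1
    exact hbint (m - 1) (by exact_mod_cast h2)
  · intro z hz
    have hm := neg_one_sub_mem_slitPlane hz
    have h0 : (-1 - z : ℂ) ≠ 0 := Complex.slitPlane_ne_zero hm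
    have h0' : (1 + z : ℂ) ≠ 0 := fun h => h0 (by linear_combination -h)
    have h1 : (1 - z : ℂ) ≠ 0 := Complex.slitPlane_ne_zero (one_sub_mem_slitPlane hz (by norm_num))
    have hv : 1 + z ∈ cutPlane 2 := fun h => hz ⟨by simpa using h.1, by
      have := h.2; simp at this; linarith⟩
    have hl : HasDerivAt (fun z : ℂ => Complex.log (-1 - z)) (-1 / (-1 - z)) z := by
      have : HasDerivAt (fun z : ℂ => -1 - z) (-1) z := by
        simpa using (hasDerivAt_id z).const_sub (-1)
      exact this.clog hm
    have hG : HasDerivAt (fun z => eulerIntegral a b (1 + z)) _ z :=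
      (hasDerivAt_eulerIntegral ha hb hv).2.comp_const_add 1 z
    have key := eulerIntegral_add_mul_deriv ha hb hv
    generalize (∫ s in (0 : ℝ)..1,
      ((s ^ b : ℝ) : ℂ) * (a * (2 - s * (1 + z)) ^ (a - 1 : ℂ) * -s)) = J at hG key
    refine ((hl.const_mul (b + 1 : ℂ)).cexp.neg.mul hG).congr_deriv ?_
    rw [show (2 : ℂ) - (1 + z) = 1 - z by ring, Complex.cpow_def_of_ne_zero h1] at key
    have he : Complex.exp ((b + 1) * Complex.log (-1 - z)) =
        (-1 - z) * Complex.exp (b * Complex.log (-1 - z)) := by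
      rw [add_mul, one_mul, Complex.exp_add, Complex.exp_log h0, mul_comm]
    simp only [Pi.neg_apply]
    rw [he, Complex.exp_add, mul_comm (a : ℂ), ← key]
    field_simp
    ring
  · refine (Complex.tendsto_log_nhdsWithin_im_nonneg_of_re_neg_of_im_zero (z := -2) (by simp)
      (by simp)).comp (tendsto_nhdsWithin_iff.2 ⟨hnhds _, ?_⟩)
    filter_upwards [self_mem_nhdsWithin] with z hz
    have : z.im < 0 := hz
    simp [this.le]
  · refine (Complex.tendsto_log_nhdsWithin_im_neg_of_re_neg_of_im_zero (z := -2) (by simp)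
      (by simp)).comp (tendsto_nhdsWithin_iff.2 ⟨hnhds _, ?_⟩)
    filter_upwards [self_mem_nhdsWithin] with z hz
    have : 0 < z.im := hz
    simp [this]

/-! ### The functional on curves around `-1` -/

theorem logPair_cutPlane : LogPair (cutPlane (-1)) (fun z => Complex.log (1 - z))
    (fun z => Complex.log (-1 - z) + Real.pi * Complex.I) where
  exp_left z hz := Complex.exp_log
    (Complex.slitPlane_ne_zero (one_sub_mem_slitPlane hz (by norm_num)))
  exp_right z hz := by
    rw [Complex.exp_add, Complex.exp_log (Complex.slitPlane_ne_zero (neg_one_sub_mem_slitPlane hz)),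
      Complex.exp_pi_mul_I]
    ring
  deriv_left z hz := by
    have : HasDerivAt (fun z : ℂ => 1 - z) (-1) z := by
      simpa using (hasDerivAt_id z).const_sub 1
    refine (this.clog (one_sub_mem_slitPlane hz (by norm_num))).congr_deriv ?_
    rw [neg_div, one_div]
  deriv_right z hz := by
    have : HasDerivAt (fun z : ℂ => -1 - z) (-1) z := by
      simpa using (hasDerivAt_id z).const_sub (-1)
    refine ((this.clog (neg_one_sub_mem_slitPlane hz)).add_const _).congr_deriv ?_
    rw [neg_div, one_div, ← inv_neg]
    congr 1; ring

/-- The zero of `1 - z²` at `1` improves the modulus to `|1 - z|^(α + 1)` times a function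
continuous there, and `α + 1 > 0`. -/
theorem tendsto_boundary_one {D : Set ℂ} {A B : ℂ → ℂ} (h : LogPair D A B) {α β : ℝ} (hα : -1 < α)
    (g : ℂ[X]) {γ : ℝ → ℂ} {l : Filter ℝ} (hγ : Tendsto γ l (𝓝 1)) (hD : ∀ᶠ s in l, γ s ∈ D) :
    Tendsto (fun s => (1 - γ s ^ 2) * g.eval (γ s) *
      Complex.exp (α * A (γ s) + β * B (γ s))) l (𝓝 0) := by
  rw [tendsto_zero_iff_norm_tendsto_zero]
  have hcont : ContinuousAt
      (fun z : ℂ => ‖1 - z‖ ^ (α + 1) * (‖z + 1‖ * ‖z + 1‖ ^ β * ‖g.eval z‖)) 1 := by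
    refine ContinuousAt.mul ?_ (ContinuousAt.mul (ContinuousAt.mul (by fun_prop) ?_) ?_)
    · exact ContinuousAt.rpow_const (by fun_prop) (Or.inr (by linarith))
    · exact ContinuousAt.rpow_const (by fun_prop) (Or.inl (by norm_num))
    · exact (g.continuous.norm).continuousAt
  have h0 : Tendsto (fun z : ℂ => ‖1 - z‖ ^ (α + 1) * (‖z + 1‖ * ‖z + 1‖ ^ β * ‖g.eval z‖))
      (𝓝 1) (𝓝 0) := by
    have := hcont.tendsto
    rwa [sub_self, norm_zero, Real.zero_rpow (by linarith), zero_mul] at this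
  refine (h0.comp hγ).congr' ?_
  filter_upwards [hD] with s hs
  rw [norm_mul, h.norm_exp α β hs, norm_mul, show 1 - γ s ^ 2 = (1 - γ s) * (γ s + 1) by ring,
    norm_mul, Function.comp, Real.rpow_add_one (norm_ne_zero_iff.2 (h.one_sub_ne_zero hs))]
  ring

theorem IsGammaOne.mem_cutPlane {γ : ℝ → ℂ} (hγ : IsGammaOne γ) {s : ℝ}
    (hs : s ∈ Ioo (0 : ℝ) 1) : γ s ∈ cutPlane (-1) := hγ.avoids s hs

theorem IsGammaOne.pearsonFunctional {α β : ℝ} {k N : ℕ} {γ W : ℝ → ℂ} (hγ : IsGammaOne γ)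
    (hW : IsWeightBranch α β γ (Ioo 0 1) W) (hα : -1 < α) (hβk : -1 < β + k)
    (hβ : ∀ m : ℤ, β ≠ m) (hN : k + 2 ≤ N) :
    PearsonFunctional α β N (fun f a => HasCurveIntegral γ (fun s => f.eval (γ s) * W s) a) := by
  have hLP := logPair_cutPlane
  have hD : ∀ s ∈ Ioo (0 : ℝ) 1, γ s ∈ cutPlane (-1) := fun s hs => hγ.mem_cutPlane hs
  obtain ⟨c, hc0, hc⟩ := hLP.exists_eq_mul isPreconnected_Ioo hγ.isCurve.continuousOn hD hW
  refine hLP.pearsonFunctional hγ.isCurve hD hc (fun g _ => tendsto_boundary_one hLP hα g hγ.start ?_)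
    (fun g _ => tendsto_boundary_one hLP hα g hγ.finish ?_) ?_
  · filter_upwards [Ioo_mem_nhdsGT zero_lt_one] using hD
  · filter_upwards [Ioo_mem_nhdsLT zero_lt_one] using hD
  -- The primitive needs a first exponent above `1` and a second above `-1`. Testing with `(1 - X)^2
  -- (X + 1)^k` provides both, which is why the degree bound must reach `k + 2`.
  obtain ⟨F, l₁, l₂, hne, hF, hl₁, hl₂⟩ := exists_primitive (a := α + 2) (b := β + k)
    (by linarith) hβk fun m hm => hβ (m - k) (by push_cast; linarith)
  have hint := hasCurveIntegral_of_hasDerivAt hγ.isCurve hD hF (by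
      refine (continuousOn_const.mul ?_).add (continuousOn_const.mul ?_) |>.cexp
      · exact fun z hz => (hLP.deriv_left z hz).continuousAt.continuousWithinAt
      · refine ContinuousOn.clog (by fun_prop) fun z hz => neg_one_sub_mem_slitPlane hz)
    (hl₁.comp (tendsto_nhdsWithin_iff.2 ⟨hγ.start, hγ.start_below⟩))
    (hl₂.comp (tendsto_nhdsWithin_iff.2 ⟨hγ.finish, hγ.finish_above⟩))
  refine ⟨(1 - X) ^ 2 * (X + 1) ^ k, c * Complex.exp ((β + k) * (Real.pi * Complex.I)) * (l₂ - l₁),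
    ?_, mul_ne_zero (mul_ne_zero hc0 (Complex.exp_ne_zero _)) (sub_ne_zero.2 hne.symm), ?_⟩
  · refine le_trans ?_ hN
    compute_degree!
    omega
  · refine hasCurveIntegral_congr (hint.const_mul _) fun s hs => ?_
    have := hLP.exp_add_natCast α β 2 k (hD s hs)
    simp only [eval_mul, eval_pow, eval_sub, eval_add, eval_one, eval_X]
    rw [hc s hs, mul_left_comm ((1 - γ s) ^ 2 * _), ← this, mul_assoc, ← Complex.exp_add]
    congr 2
    push_cast
    ring

/-! ### The functional on curves through infinity -/

/-- `Γ_∞` with either orientation. -/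
structure IsGammaInftyUnoriented (γ : ℝ → ℂ) : Prop where
  isCurve : IsCurve γ
  avoids : ∀ s ∈ Ioo (0 : ℝ) 1, ¬ ((γ s).im = 0 ∧ ((γ s).re ≤ -1 ∨ 1 ≤ (γ s).re))
  start : Tendsto (fun s => ‖γ s‖) (𝓝[>] 0) atTop
  finish : Tendsto (fun s => ‖γ s‖) (𝓝[<] 1) atTop
  sides : ((∀ᶠ s in 𝓝[>] 0, 0 < (γ s).im) ∧ ∀ᶠ s in 𝓝[<] 1, (γ s).im < 0) ∨
    ((∀ᶠ s in 𝓝[>] 0, (γ s).im < 0) ∧ ∀ᶠ s in 𝓝[<] 1, 0 < (γ s).im)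

/-- The plane cut along `(-∞, -1]` and `[1, ∞)`. -/
def doublyCutPlane : Set ℂ := {z | ¬ (z.im = 0 ∧ (z.re ≤ -1 ∨ 1 ≤ z.re))}

/-- The Möbius transformation fixing `-1` and exchanging `1` and `∞`. -/
def swapOneInfty (z : ℂ) : ℂ := (z + 3) / (z - 1)

theorem ne_one_of_mem_doublyCutPlane {z : ℂ} (hz : z ∈ doublyCutPlane) : z - 1 ≠ 0 := by
  intro h
  rw [sub_eq_zero] at h
  subst h
  exact hz ⟨by simp, Or.inr (by simp)⟩

theorem swapOneInfty_eq {z : ℂ} (hz : z - 1 ≠ 0) : swapOneInfty z = 1 + 4 / (z - 1) := by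
  rw [swapOneInfty]; field_simp; ring

theorem swapOneInfty_mem {z : ℂ} (hz : z ∈ doublyCutPlane) : swapOneInfty z ∈ cutPlane (-1) := by
  have h1 := ne_one_of_mem_doublyCutPlane hz
  rintro ⟨him, hre⟩
  obtain ⟨x, hx⟩ : ∃ x : ℝ, swapOneInfty z = x :=
    ⟨(swapOneInfty z).re, Complex.ext rfl (by simpa using him)⟩
  rw [hx, Complex.ofReal_re] at hre
  rw [swapOneInfty_eq h1] at hx
  have hx1 : (x : ℂ) - 1 ≠ 0 := by
    rw [← hx, add_sub_cancel_left]
    exact div_ne_zero (by norm_num) h1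
  have hz' : z = ((1 + 4 / (x - 1) : ℝ) : ℂ) := by
    push_cast
    rw [← hx]; field_simp; ring
  have hx1' : x - 1 ≠ 0 := by exact_mod_cast hx1
  rw [hz'] at hz
  refine hz ⟨Complex.ofReal_im _, ?_⟩
  rw [Complex.ofReal_re]
  rcases lt_or_gt_of_ne hx1' with h | h
  · left
    have : 4 / (x - 1) ≤ -2 := by
      rw [div_le_iff_of_neg h]; linarith
    linarith
  · right
    have : 0 < 4 / (x - 1) := by positivity
    linarith

theorem hasDerivAt_swapOneInfty {z : ℂ} (hz : z - 1 ≠ 0) :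
    HasDerivAt swapOneInfty (-4 / (z - 1) ^ 2) z := by
  refine (((hasDerivAt_id z).add_const 3).div ((hasDerivAt_id z).sub_const 1) hz).congr_deriv ?_
  simp only [id]
  congr 1; ring

theorem one_sub_swapOneInfty {z : ℂ} (hz : z - 1 ≠ 0) : 1 - swapOneInfty z = -4 / (z - 1) := by
  rw [swapOneInfty]; field_simp; ring

theorem neg_one_sub_swapOneInfty {z : ℂ} (hz : z - 1 ≠ 0) :
    -1 - swapOneInfty z = -2 * (z + 1) / (z - 1) := by
  rw [swapOneInfty]; field_simp; ring

theorem exp_ofReal_log {x : ℝ} (hx : 0 < x) : Complex.exp (Real.log x) = x := by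
  rw [← Complex.ofReal_exp, Real.exp_log hx]

theorem logPair_doublyCutPlane : LogPair doublyCutPlane
    (fun z => Real.log 4 - Complex.log (1 - swapOneInfty z))
    (fun z => Complex.log (-1 - swapOneInfty z) - Real.log 2 +
      (Real.log 4 - Complex.log (1 - swapOneInfty z))) := by
  have hA : ∀ z ∈ doublyCutPlane, Complex.exp (Real.log 4 - Complex.log (1 - swapOneInfty z)) =
      1 - z := fun z hz => by
    have h1 := ne_one_of_mem_doublyCutPlane hz
    rw [Complex.exp_sub, exp_ofReal_log (by norm_num), Complex.exp_log (Complex.slitPlane_ne_zero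
      (one_sub_mem_slitPlane (swapOneInfty_mem hz) (by norm_num))), one_sub_swapOneInfty h1]
    push_cast
    field_simp; ring
  have hA' : ∀ z ∈ doublyCutPlane, HasDerivAt
      (fun z => Real.log 4 - Complex.log (1 - swapOneInfty z)) (-(1 - z)⁻¹) z := fun z hz => by
    have h1 := ne_one_of_mem_doublyCutPlane hz
    have h1' : 1 - z ≠ 0 := fun h => h1 (by linear_combination -h)
    refine (((hasDerivAt_swapOneInfty h1).const_sub 1).clog (one_sub_mem_slitPlane
      (swapOneInfty_mem hz) (by norm_num)) |>.const_sub (Real.log 4 : ℂ)).congr_deriv ?_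
    rw [one_sub_swapOneInfty h1]
    field_simp
    ring
  refine ⟨hA, fun z hz => ?_, hA', fun z hz => ?_⟩
  · have h1 := ne_one_of_mem_doublyCutPlane hz
    rw [Complex.exp_add, hA z hz, Complex.exp_sub, exp_ofReal_log (by norm_num), Complex.exp_log
      (Complex.slitPlane_ne_zero (neg_one_sub_mem_slitPlane (swapOneInfty_mem hz))),
      neg_one_sub_swapOneInfty h1]
    push_cast
    field_simp; ring
  · have h1 := ne_one_of_mem_doublyCutPlane hz
    have h1' : 1 - z ≠ 0 := fun h => h1 (by linear_combination -h)
    have hm := neg_one_sub_mem_slitPlane (swapOneInfty_mem hz)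
    have h2 : z + 1 ≠ 0 := fun h => by
      have := Complex.slitPlane_ne_zero hm
      rw [neg_one_sub_swapOneInfty h1, h] at this
      simp at this
    refine (((((hasDerivAt_swapOneInfty h1).const_sub (-1)).clog hm).sub_const
      (Real.log 2 : ℂ)).add (hA' z hz)).congr_deriv ?_
    rw [neg_one_sub_swapOneInfty h1]
    field_simp
    ring

theorem tendsto_swapOneInfty : Tendsto swapOneInfty (Bornology.cobounded ℂ) (𝓝 1) := by
  have h : Tendsto (fun z : ℂ => 1 + 4 * (z - 1)⁻¹) (Bornology.cobounded ℂ) (𝓝 (1 + 4 * 0)) := by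
    refine (Tendsto.const_mul _ ?_).const_add _
    exact tendsto_inv₀_cobounded.comp (by
      simp [sub_eq_add_neg, tendsto_add_const_cobounded])
  rw [mul_zero, add_zero] at h
  refine h.congr' ?_
  have : ∀ᶠ z : ℂ in Bornology.cobounded ℂ, z ≠ 1 := by
    filter_upwards [Bornology.isBounded_def.1
      (Bornology.isBounded_singleton (x := (1 : ℂ)))] with z hz using hz
  filter_upwards [this] with z hz
  rw [swapOneInfty_eq (sub_ne_zero.2 hz), div_eq_mul_inv]

theorem im_swapOneInfty {z : ℂ} (hz : z - 1 ≠ 0) :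
    (swapOneInfty z).im = -(4 / Complex.normSq (z - 1)) * z.im := by
  rw [swapOneInfty_eq hz]
  simp [Complex.div_im]
  ring

theorem tendsto_log_norm_add_sub (w : ℂ) :
    Tendsto (fun z : ℂ => Real.log ‖z + w‖ - Real.log ‖z‖) (Bornology.cobounded ℂ) (𝓝 0) := by
  have h : Tendsto (fun z : ℂ => Real.log ‖1 + w * z⁻¹‖) (Bornology.cobounded ℂ)
      (𝓝 (Real.log ‖1 + w * 0‖)) := by
    have h1 : Tendsto (fun z : ℂ => ‖1 + w * z⁻¹‖) (Bornology.cobounded ℂ) (𝓝 ‖1 + w * 0‖) :=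
      ((tendsto_inv₀_cobounded.const_mul w).const_add 1).norm
    exact h1.log (by simp)
  simp only [mul_zero, add_zero, norm_one, Real.log_one] at h
  refine h.congr' ?_
  filter_upwards [tendsto_norm_cobounded_atTop.eventually_gt_atTop ‖w‖] with z hz
  have hz0 : z ≠ 0 := by
    rintro rfl
    exact absurd hz (by simp)
  have hzw : z + w ≠ 0 := fun h => by
    rw [eq_neg_of_add_eq_zero_left h] at hz
    simp at hz
  rw [← Real.log_div (norm_ne_zero_iff.2 hzw) (norm_ne_zero_iff.2 hz0), ← norm_div]
  congr 2
  field_simp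

theorem norm_eval_le (f : ℂ[X]) {M : ℕ} (hf : f.natDegree ≤ M) :
    ∃ C, ∀ z : ℂ, 1 ≤ ‖z‖ → ‖f.eval z‖ ≤ C * ‖z‖ ^ M := by
  refine ⟨∑ i ∈ Finset.range (M + 1), ‖f.coeff i‖, fun z hz => ?_⟩
  rw [eval_eq_sum_range' (Nat.lt_succ_of_le hf), Finset.sum_mul]
  refine (norm_sum_le _ _).trans (Finset.sum_le_sum fun i hi => ?_)
  rw [norm_mul, norm_pow]
  gcongr
  exact Nat.lt_succ_iff.1 (Finset.mem_range.1 hi)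

/-- Both `|1 - z|` and `|z + 1|` are asymptotic to `|z|`, so the product is bounded by a multiple of
`|z|^(M + α + β)` near infinity. -/
theorem tendsto_eval_mul_weight_cobounded (f : ℂ[X]) {M : ℕ} (hf : f.natDegree ≤ M) {α β : ℝ}
    (h : M + α + β < 0) :
    Tendsto (fun z : ℂ => ‖f.eval z‖ * (‖1 - z‖ ^ α * ‖z + 1‖ ^ β)) (Bornology.cobounded ℂ)
      (𝓝 0) := by
  obtain ⟨C, hC⟩ := norm_eval_le f hf
  have h1 : Tendsto (fun z : ℂ => C * (‖z‖ ^ (M + α + β) *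
      Real.exp (α * (Real.log ‖z + -1‖ - Real.log ‖z‖) + β * (Real.log ‖z + 1‖ - Real.log ‖z‖))))
      (Bornology.cobounded ℂ) (𝓝 (C * (0 * Real.exp (α * 0 + β * 0)))) := by
    refine (Tendsto.mul ?_ ?_).const_mul C
    · have := (tendsto_rpow_neg_atTop (y := -(M + α + β)) (by linarith)).comp
        (tendsto_norm_cobounded_atTop (E := ℂ))
      simpa [Function.comp_def] using this
    · exact (Real.continuous_exp.tendsto _).comp
        (((tendsto_log_norm_add_sub _).const_mul α).add ((tendsto_log_norm_add_sub _).const_mul β))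
  rw [zero_mul, mul_zero] at h1
  refine squeeze_zero' (.of_forall fun z => by positivity) ?_ h1
  filter_upwards [tendsto_norm_cobounded_atTop.eventually_gt_atTop 1] with z hz
  have hz0 : 0 < ‖z‖ := by linarith
  have hm : 0 < ‖z + -1‖ := norm_pos_iff.2 fun h => by
    rw [eq_neg_of_add_eq_zero_left h] at hz; simp at hz
  have hp : 0 < ‖z + 1‖ := norm_pos_iff.2 fun h => by
    rw [eq_neg_of_add_eq_zero_left h] at hz; simp at hz
  have key : ‖z‖ ^ (M + α + β) * Real.exp (α * (Real.log ‖z + -1‖ - Real.log ‖z‖) +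
      β * (Real.log ‖z + 1‖ - Real.log ‖z‖)) = ‖z‖ ^ M * (‖1 - z‖ ^ α * ‖z + 1‖ ^ β) := by
    rw [norm_sub_rev, sub_eq_add_neg z 1, ← Real.rpow_natCast, Real.rpow_def_of_pos hz0,
      Real.rpow_def_of_pos hm, Real.rpow_def_of_pos hp, Real.rpow_def_of_pos hz0, ← Real.exp_add,
      ← Real.exp_add, ← Real.exp_add]
    congr 1; ring
  rw [key, ← mul_assoc C]
  exact mul_le_mul_of_nonneg_right (hC z hz.le) (by positivity)

theorem natDegree_one_sub_X_sq_mul_le {N : ℕ} {g : ℂ[X]} (hg : g.natDegree < N) :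
    ((1 - X ^ 2) * g).natDegree ≤ N + 1 := by
  refine natDegree_mul_le.trans ?_
  have : (1 - X ^ 2 : ℂ[X]).natDegree ≤ 2 := by compute_degree
  omega

theorem tendsto_boundary_infty {D : Set ℂ} {A B : ℂ → ℂ} (h : LogPair D A B) {α β : ℝ} {N : ℕ}
    (hN : N + 1 + α + β < 0) {g : ℂ[X]} (hg : g.natDegree < N) {γ : ℝ → ℂ} {l : Filter ℝ}
    (hγ : Tendsto (fun s => ‖γ s‖) l atTop) (hD : ∀ᶠ s in l, γ s ∈ D) :
    Tendsto (fun s => (1 - γ s ^ 2) * g.eval (γ s) *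
      Complex.exp (α * A (γ s) + β * B (γ s))) l (𝓝 0) := by
  rw [tendsto_zero_iff_norm_tendsto_zero]
  refine ((tendsto_eval_mul_weight_cobounded _ (natDegree_one_sub_X_sq_mul_le hg)
    (by push_cast; exact hN)).comp (tendsto_norm_atTop_iff_cobounded.1 hγ)).congr' ?_
  filter_upwards [hD] with s hs
  rw [norm_mul, h.norm_exp α β hs, Function.comp]
  simp

/-- The map `swapOneInfty` turns the curve into one with both ends at `1`, approached from opposite
sides of the cut `[-1, ∞)`, where `exists_primitive` shows that the test integral is nonzero. -/
theorem IsGammaInftyUnoriented.pearsonFunctional {α β : ℝ} {k N : ℕ} {γ W : ℝ → ℂ}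
    (hγ : IsGammaInftyUnoriented γ) (hW : IsWeightBranch α β γ (Ioo 0 1) W) (hβk : -1 < β + k)
    (hβ : ∀ m : ℤ, β ≠ m) (hN : N + 1 + α + β < 0) (hk : k + 2 ≤ N) :
    PearsonFunctional α β N (fun f a => HasCurveIntegral γ (fun s => f.eval (γ s) * W s) a) := by
  have hLP := logPair_doublyCutPlane
  have hD : ∀ s ∈ Ioo (0 : ℝ) 1, γ s ∈ doublyCutPlane := fun s hs => hγ.avoids s hs
  have hD0 : ∀ᶠ s in 𝓝[>] 0, γ s ∈ doublyCutPlane := by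
    filter_upwards [Ioo_mem_nhdsGT zero_lt_one] using hD
  have hD1 : ∀ᶠ s in 𝓝[<] 1, γ s ∈ doublyCutPlane := by
    filter_upwards [Ioo_mem_nhdsLT zero_lt_one] using hD
  obtain ⟨c, hc0, hc⟩ := hLP.exists_eq_mul isPreconnected_Ioo hγ.isCurve.continuousOn hD hW
  refine hLP.pearsonFunctional hγ.isCurve hD hc
    (fun g hg => tendsto_boundary_infty hLP hN hg hγ.start hD0)
    (fun g hg => tendsto_boundary_infty hLP hN hg hγ.finish hD1) ?_
  have hkN : (k : ℝ) + 2 ≤ N := by exact_mod_cast hk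
  -- With `u = swapOneInfty z`, the form `(1 - u)^a (-1 - u)^b du` is a constant times `(1 - z)^(-a
  -- - b - 2) (z + 1)^b dz`. Taking `b = β + k`, the exponent of `1 - z` equals `α` for this `a`;
  -- the degree hypotheses give `1 < a`.
  obtain ⟨F, l₁, l₂, hne, hF, hl₁, hl₂⟩ := exists_primitive (a := -α - β - k - 2) (b := β + k)
    (by linarith) hβk fun m hm => hβ (m - k) (by push_cast; linarith)
  -- The Möbius map reverses the sign of the imaginary part, so the upper half plane leads to the
  -- limit from below.
  have hbelow : ∀ l : Filter ℝ, Tendsto (fun s => ‖γ s‖) l atTop → (∀ᶠ s in l, γ s ∈ doublyCutPlane) →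
      (∀ᶠ s in l, 0 < (γ s).im) → Tendsto (fun s => F (swapOneInfty (γ s))) l (𝓝 l₁) := by
    intro l hl hlD him
    refine hl₁.comp (tendsto_nhdsWithin_iff.2
      ⟨tendsto_swapOneInfty.comp (tendsto_norm_atTop_iff_cobounded.1 hl), ?_⟩)
    filter_upwards [hlD, him] with s hs hi
    have h1 := ne_one_of_mem_doublyCutPlane hs
    have := Complex.normSq_pos.2 h1
    change (swapOneInfty (γ s)).im < 0
    rw [im_swapOneInfty h1, neg_mul, neg_lt_zero]
    positivity
  have habove : ∀ l : Filter ℝ, Tendsto (fun s => ‖γ s‖) l atTop → (∀ᶠ s in l, γ s ∈ doublyCutPlane) →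
      (∀ᶠ s in l, (γ s).im < 0) → Tendsto (fun s => F (swapOneInfty (γ s))) l (𝓝 l₂) := by
    intro l hl hlD him
    refine hl₂.comp (tendsto_nhdsWithin_iff.2
      ⟨tendsto_swapOneInfty.comp (tendsto_norm_atTop_iff_cobounded.1 hl), ?_⟩)
    filter_upwards [hlD, him] with s hs hi
    have h1 := ne_one_of_mem_doublyCutPlane hs
    have := Complex.normSq_pos.2 h1
    change 0 < (swapOneInfty (γ s)).im
    rw [im_swapOneInfty h1]
    exact mul_pos_of_neg_of_neg (neg_neg_of_pos (by positivity)) hi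
  -- The constant collects the factors `4` and `2` from `1 - u = 4 / (1 - z)` and `-1 - u = 2 (z +
  -- 1) / (1 - z)`, and the `-4` from `du`.
  set d : ℂ := -4 * Complex.exp ((-α - β - k - 2) * Real.log 4 + (β + k) * Real.log 2) with hd
  have hd0 : d ≠ 0 := mul_ne_zero (by norm_num) (Complex.exp_ne_zero _)
  have hderiv : ∀ z ∈ doublyCutPlane, HasDerivAt (fun z => F (swapOneInfty z))
      (d * ((z + 1) ^ k * Complex.exp (α * (Real.log 4 - Complex.log (1 - swapOneInfty z)) +
        β * (Complex.log (-1 - swapOneInfty z) - Real.log 2 +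
          (Real.log 4 - Complex.log (1 - swapOneInfty z)))))) z := by
    intro z hz
    have h1 := ne_one_of_mem_doublyCutPlane hz
    refine ((hF _ (swapOneInfty_mem hz)).comp z (hasDerivAt_swapOneInfty h1)).congr_deriv ?_
    have e1 := hLP.exp_add_natCast α β 0 k hz
    have e2 := hLP.exp_left z hz
    rw [pow_zero, one_mul] at e1
    rw [← e1, show (z - 1) ^ 2 = (1 - z) ^ 2 by ring, ← e2, ← Complex.exp_nat_mul, neg_div,
      div_eq_mul_inv, ← Complex.exp_neg, hd, mul_assoc, ← Complex.exp_add, ← neg_mul,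
      mul_left_comm, ← Complex.exp_add]
    congr 2
    push_cast
    ring
  have hcont : ContinuousOn (fun z => d * ((z + 1) ^ k * Complex.exp (α * (Real.log 4 -
      Complex.log (1 - swapOneInfty z)) + β * (Complex.log (-1 - swapOneInfty z) - Real.log 2 +
        (Real.log 4 - Complex.log (1 - swapOneInfty z)))))) doublyCutPlane :=
    continuousOn_const.mul (ContinuousOn.mul (by fun_prop) (hLP.continuousOn_exp α β))
  have hdeg : ((X + 1 : ℂ[X]) ^ k).natDegree ≤ N := by
    refine le_trans ?_ (show k ≤ N by omega)
    compute_degree!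
  have main : ∃ a ≠ 0, HasCurveIntegral γ (fun s => d * ((γ s + 1) ^ k * Complex.exp (α *
      (Real.log 4 - Complex.log (1 - swapOneInfty (γ s))) + β * (Complex.log
        (-1 - swapOneInfty (γ s)) - Real.log 2 +
          (Real.log 4 - Complex.log (1 - swapOneInfty (γ s))))))) a := by
    rcases hγ.sides with ⟨h0, h1⟩ | ⟨h0, h1⟩
    · exact ⟨_, sub_ne_zero.2 hne.symm, hasCurveIntegral_of_hasDerivAt hγ.isCurve hD hderiv hcont
        (hbelow _ hγ.start hD0 h0) (habove _ hγ.finish hD1 h1)⟩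
    · exact ⟨_, sub_ne_zero.2 hne, hasCurveIntegral_of_hasDerivAt hγ.isCurve hD hderiv hcont
        (habove _ hγ.start hD0 h0) (hbelow _ hγ.finish hD1 h1)⟩
  obtain ⟨a, ha, hint⟩ := main
  refine ⟨(X + 1) ^ k, c * d⁻¹ * a, hdeg, mul_ne_zero (mul_ne_zero hc0 (inv_ne_zero hd0)) ha,
    hasCurveIntegral_congr (hint.const_mul _) fun s hs => ?_⟩
  simp only [eval_pow, eval_add, eval_one, eval_X]
  rw [hc s hs]
  field_simp

/-! ### The weight on the real line -/

/-- The positive weight `|1 - t|ᵃ |1 + t|ᵇ` (for `t ≠ ±1`). -/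
def realWeight (a b t : ℝ) : ℝ := Real.exp (a * Real.log (1 - t) + b * Real.log (1 + t))

theorem realWeight_pos (a b t : ℝ) : 0 < realWeight a b t := Real.exp_pos _

theorem IsWeightBranch.eq_mul_realWeight_Ioo {a b : ℝ} {V : ℝ → ℂ}
    (hV : IsWeightBranch a b (fun t => (t : ℂ)) (Ioo (-1) 1) V) :
    ∃ c ≠ 0, ∀ t ∈ Ioo (-1 : ℝ) 1, V t = c * realWeight a b t := by
  have hex := hV.exists_eq_mul (A := fun t => Real.log (1 - t))
    (B := fun t => Real.log (1 + t)) isPreconnected_Ioo ?_ ?_ ?_ ?_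
  · obtain ⟨c, hc, h⟩ := hex
    refine ⟨c, hc, fun t ht => ?_⟩
    rw [h t ht, realWeight]; push_cast; ring_nf
  · refine Complex.continuous_ofReal.comp_continuousOn (ContinuousOn.log (by fun_prop) ?_)
    intro t ht; linarith [ht.2]
  · refine Complex.continuous_ofReal.comp_continuousOn (ContinuousOn.log (by fun_prop) ?_)
    intro t ht; linarith [ht.1]
  · intro t ht
    rw [exp_ofReal_log (by linarith [ht.2])]; push_cast; rfl
  · intro t ht
    rw [exp_ofReal_log (by linarith [ht.1])]; push_cast; ring

/-- Left of `-1` a logarithm of `1 + t` is `log |1 + t| + πi`; the phase `exp (πi b)` goes into the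
constant. `Real.log` already ignores signs. -/
theorem IsWeightBranch.eq_mul_realWeight_Iio {a b : ℝ} {V : ℝ → ℂ}
    (hV : IsWeightBranch a b (fun t => (t : ℂ)) (Iio (-1)) V) :
    ∃ c ≠ 0, ∀ t ∈ Iio (-1 : ℝ), V t = c * realWeight a b t := by
  have hex := hV.exists_eq_mul (A := fun t => Real.log (1 - t))
    (B := fun t => Real.log (1 + t) + Real.pi * Complex.I) isPreconnected_Iio ?_ ?_ ?_ ?_
  · obtain ⟨c, hc, h⟩ := hex
    refine ⟨c * Complex.exp (b * (Real.pi * Complex.I)), mul_ne_zero hc (Complex.exp_ne_zero _),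
      fun t ht => ?_⟩
    rw [h t ht, realWeight, mul_assoc, Complex.ofReal_exp, ← Complex.exp_add]
    congr 2
    push_cast; ring
  · refine Complex.continuous_ofReal.comp_continuousOn (ContinuousOn.log (by fun_prop) ?_)
    intro t ht h
    have : t < -1 := ht
    linarith
  · refine (Complex.continuous_ofReal.comp_continuousOn
      (ContinuousOn.log (by fun_prop) ?_)).add continuousOn_const
    intro t ht h
    have : t < -1 := ht
    linarith
  · intro t ht
    have : t < -1 := ht
    rw [exp_ofReal_log (by linarith)]; push_cast; rfl
  · intro t ht
    have : t < -1 := ht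
    rw [Complex.exp_add, Complex.exp_pi_mul_I, ← Real.log_neg_eq_log, exp_ofReal_log (by linarith)]
    push_cast; ring

theorem hasDerivAt_realWeight (a b : ℝ) {t : ℝ} (h1 : 1 - t ≠ 0) (h2 : 1 + t ≠ 0) :
    HasDerivAt (realWeight a b) ((-a * (1 - t)⁻¹ + b * (1 + t)⁻¹) * realWeight a b t) t := by
  have e1 : HasDerivAt (fun t : ℝ => 1 - t) (-1) t := by simpa using (hasDerivAt_id t).const_sub 1
  have e2 : HasDerivAt (fun t : ℝ => 1 + t) 1 t := by simpa using (hasDerivAt_id t).const_add 1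
  refine (((e1.log h1).const_mul a).add ((e2.log h2).const_mul b)).exp.congr_deriv ?_
  simp only [realWeight, Pi.add_apply]
  ring

theorem hasDerivAt_pearson_real (a b : ℝ) (g : ℂ[X]) {t : ℝ} (h1 : 1 - t ≠ 0) (h2 : 1 + t ≠ 0) :
    HasDerivAt (fun t : ℝ => (1 - (t : ℂ) ^ 2) * g.eval (t : ℂ) * realWeight a b t)
      ((pearson a b g).eval (t : ℂ) * realWeight a b t) t := by
  have h1' : (1 - t : ℂ) ≠ 0 := by exact_mod_cast h1
  have h2' : (1 + t : ℂ) ≠ 0 := by exact_mod_cast h2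
  have h3 : HasDerivAt (fun z : ℂ => 1 - z ^ 2) (-(2 * (t : ℂ))) t := by
    simpa using (hasDerivAt_pow 2 (t : ℂ)).const_sub 1
  refine ((h3.mul (g.hasDerivAt (t : ℂ))).comp_ofReal.mul
    (hasDerivAt_realWeight a b h1 h2).ofReal_comp).congr_deriv ?_
  rw [eval_pearson]
  simp only [Pi.mul_apply]
  push_cast
  field_simp
  ring

theorem continuousOn_eval_mul_realWeight (a b : ℝ) (f : ℂ[X]) {S : Set ℝ}
    (hS : ∀ t ∈ S, 1 - t ≠ 0 ∧ 1 + t ≠ 0) :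
    ContinuousOn (fun t : ℝ => f.eval (t : ℂ) * realWeight a b t) S :=
  (f.continuous.comp Complex.continuous_ofReal).continuousOn.mul
    (Complex.continuous_ofReal.comp_continuousOn fun t ht =>
      (hasDerivAt_realWeight a b (hS t ht).1 (hS t ht).2).continuousAt.continuousWithinAt)

/-- Nontriviality costs nothing here: the constant polynomial `1` has nonzero integral because the
weight is a constant multiple of a positive function. -/
theorem pearsonFunctional_interval {a b : ℝ} {Δ : Set ℝ} (hΔ : MeasurableSet Δ)
    (hΔ0 : 0 < volume Δ) {V : ℝ → ℂ} {c : ℂ} (hc0 : c ≠ 0)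
    (hc : ∀ t ∈ Δ, V t = c * realWeight a b t) {N : ℕ}
    (hint : ∀ f : ℂ[X], f.natDegree ≤ N →
      IntegrableOn (fun t : ℝ => f.eval (t : ℂ) * realWeight a b t) Δ)
    (hpearson : ∀ g : ℂ[X], g.natDegree < N →
      ∫ t in Δ, (pearson a b g).eval (t : ℂ) * realWeight a b t = 0) :
    PearsonFunctional a b N (fun f L => IntegrableOn (fun t : ℝ => f.eval (t : ℂ) * V t) Δ ∧
      ∫ t in Δ, f.eval (t : ℂ) * V t = L) := by
  have hV : ∀ f : ℂ[X], EqOn (fun t : ℝ => c * (f.eval (t : ℂ) * realWeight a b t))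
      (fun t : ℝ => f.eval (t : ℂ) * V t) Δ := fun f t ht => by
    simp only [hc t ht]; ring
  have hval : ∀ f : ℂ[X], f.natDegree ≤ N → IntegrableOn (fun t : ℝ => f.eval (t : ℂ) * V t) Δ ∧
      ∫ t in Δ, f.eval (t : ℂ) * V t = c * ∫ t in Δ, f.eval (t : ℂ) * realWeight a b t := by
    intro f hf
    refine ⟨IntegrableOn.congr_fun ((hint f hf).const_mul c) (hV f) hΔ, ?_⟩
    rw [← setIntegral_congr_fun hΔ (hV f), integral_const_mul]
  refine ⟨fun h1 h2 => ?_, fun d h1 => ?_, fun h1 h2 => h1.2.symm.trans h2.2, fun g hg => ?_, ?_⟩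
  · simp only [eval_add, add_mul]
    exact ⟨h1.1.add h2.1, by rw [integral_add h1.1 h2.1, h1.2, h2.2]⟩
  · simp only [eval_mul, eval_C, mul_assoc]
    exact ⟨h1.1.const_mul d, by rw [integral_const_mul, h1.2]⟩
  · have := hval (pearson a b g) ((natDegree_pearson_le _ _ _).trans hg)
    rwa [hpearson g hg, mul_zero] at this
  · have h1 := hint 1 (by simp)
    simp only [eval_one, one_mul] at h1
    have h1' : IntegrableOn (realWeight a b) Δ := h1.re
    have hpos : 0 < ∫ t in Δ, realWeight a b t := by
      rw [setIntegral_pos_iff_support_of_nonneg_ae (.of_forall fun t => (realWeight_pos a b t).le)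
        h1']
      rwa [show Function.support (realWeight a b) = univ from
        eq_univ_of_forall fun t => (realWeight_pos a b t).ne', univ_inter]
    refine ⟨1, _, by simp, ?_, hval 1 (by simp)⟩
    simp only [eval_one, one_mul]
    have e : ∫ t in Δ, (realWeight a b t : ℂ) = ((∫ t in Δ, realWeight a b t : ℝ) : ℂ) :=
      integral_ofReal
    rw [e]
    exact mul_ne_zero hc0 (Complex.ofReal_ne_zero.2 hpos.ne')

/-! ### The interval `(-1, 1)` -/

theorem realWeight_eq_of_mem_Ioo (a b : ℝ) {t : ℝ} (ht : t ∈ Ioo (-1 : ℝ) 1) :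
    realWeight a b t = (1 - t) ^ a * (1 + t) ^ b := by
  rw [realWeight, Real.rpow_def_of_pos (by linarith [ht.2]), Real.rpow_def_of_pos
    (by linarith [ht.1]), ← Real.exp_add]
  congr 1; ring

theorem integrableOn_realWeight_Ioo {a b : ℝ} (ha : -1 < a) (hb : -1 < b) :
    IntegrableOn (realWeight a b) (Ioo (-1) 1) := by
  have hE : EqOn (fun t : ℝ => (1 - t) ^ a * (1 + t) ^ b) (realWeight a b) (Ioo (-1) 1) :=
    fun t ht => (realWeight_eq_of_mem_Ioo a b ht).symm
  refine IntegrableOn.congr_fun ?_ hE measurableSet_Ioo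
  have h1 : IntervalIntegrable (fun t : ℝ => (1 + t) ^ b) volume (-1) 0 := by
    have := (intervalIntegral.intervalIntegrable_rpow' hb (a := 0) (b := 1)).comp_add_left 1
    simpa using this
  have h2 : IntervalIntegrable (fun t : ℝ => (1 - t) ^ a) volume 0 1 := by
    have := (intervalIntegral.intervalIntegrable_rpow' ha (a := 1) (b := 0)).comp_sub_left 1
    simpa using this
  have h3 : IntervalIntegrable (fun t : ℝ => (1 - t) ^ a * (1 + t) ^ b) volume (-1) 0 := by
    refine h1.continuousOn_mul fun t ht => ?_
    rw [uIcc_of_le (by norm_num)] at ht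
    exact (ContinuousAt.rpow_const (by fun_prop)
      (Or.inl (by linarith [ht.2]))).continuousWithinAt
  have h4 : IntervalIntegrable (fun t : ℝ => (1 - t) ^ a * (1 + t) ^ b) volume 0 1 := by
    refine h2.mul_continuousOn fun t ht => ?_
    rw [uIcc_of_le (by norm_num)] at ht
    exact (ContinuousAt.rpow_const (by fun_prop)
      (Or.inl (by linarith [ht.1]))).continuousWithinAt
  exact ((intervalIntegrable_iff_integrableOn_Ioc_of_le (by norm_num)).1 (h3.trans h4)).mono_set
    Ioo_subset_Ioc_self

theorem integrableOn_eval_mul_realWeight_Ioo {a b : ℝ} (ha : -1 < a) (hb : -1 < b) (f : ℂ[X]) :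
    IntegrableOn (fun t : ℝ => f.eval (t : ℂ) * realWeight a b t) (Ioo (-1) 1) :=
  IntegrableOn.continuousOn_mul_of_subset
    (f.continuous.comp Complex.continuous_ofReal).continuousOn
    (integrableOn_realWeight_Ioo ha hb).ofReal isCompact_Icc measurableSet_Ioo Ioo_subset_Icc_self

/-- The antiderivative contains `(1 - t)^(a + 1) (1 + t)^(b + 1)`, which extends continuously by
zero to both ends. -/
theorem integral_pearson_Ioo {a b : ℝ} (ha : -1 < a) (hb : -1 < b) (g : ℂ[X]) :
    ∫ t in Ioo (-1 : ℝ) 1, (pearson a b g).eval (t : ℂ) * realWeight a b t = 0 := by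
  have hcont : Continuous fun t : ℝ =>
      (((1 - t) ^ (a + 1) * (1 + t) ^ (b + 1) : ℝ) : ℂ) * g.eval (t : ℂ) := by
    refine (Complex.continuous_ofReal.comp (Continuous.mul ?_ ?_)).mul
      (g.continuous.comp Complex.continuous_ofReal)
    · exact Continuous.rpow_const (by fun_prop) fun _ => Or.inr (by linarith)
    · exact Continuous.rpow_const (by fun_prop) fun _ => Or.inr (by linarith)
  have hE : ∀ t ∈ Ioo (-1 : ℝ) 1, (((1 - t) ^ (a + 1) * (1 + t) ^ (b + 1) : ℝ) : ℂ) *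
      g.eval (t : ℂ) = (1 - (t : ℂ) ^ 2) * g.eval (t : ℂ) * realWeight a b t := by
    intro t ht
    rw [realWeight_eq_of_mem_Ioo a b ht, Real.rpow_add_one (by linarith [ht.2]),
      Real.rpow_add_one (by linarith [ht.1])]
    push_cast; ring
  have hl := (hcont.tendsto (-1)).mono_left (nhdsWithin_le_nhds (s := Ioi (-1)))
  have hr := (hcont.tendsto 1).mono_left (nhdsWithin_le_nhds (s := Iio 1))
  have h := intervalIntegral.integral_eq_sub_of_hasDerivAt_of_tendsto
    (by norm_num : (-1 : ℝ) < 1) (fun t ht => hasDerivAt_pearson_real a b g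
      (by linarith [ht.2]) (by linarith [ht.1])) ?_
    (hl.congr' ?_) (hr.congr' ?_)
  · rw [intervalIntegral.integral_of_le (by norm_num), integral_Ioc_eq_integral_Ioo] at h
    rw [h]
    simp [Real.zero_rpow (by linarith : a + 1 ≠ 0), Real.zero_rpow (by linarith : b + 1 ≠ 0)]
  · rw [intervalIntegrable_iff_integrableOn_Ioo_of_le (by norm_num)]
    exact integrableOn_eval_mul_realWeight_Ioo ha hb _
  · filter_upwards [Ioo_mem_nhdsGT (by norm_num : (-1 : ℝ) < 1)] using hE
  · filter_upwards [Ioo_mem_nhdsLT (by norm_num : (-1 : ℝ) < 1)] using hE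

theorem IsWeightBranch.pearsonFunctional_Ioo {a b : ℝ} (ha : -1 < a) (hb : -1 < b) {V : ℝ → ℂ}
    (hV : IsWeightBranch a b (fun t => (t : ℂ)) (Ioo (-1) 1) V) (N : ℕ) :
    PearsonFunctional a b N (fun f L =>
      IntegrableOn (fun t : ℝ => f.eval (t : ℂ) * V t) (Ioo (-1) 1) ∧
        ∫ t in Ioo (-1 : ℝ) 1, f.eval (t : ℂ) * V t = L) := by
  obtain ⟨c, hc0, hc⟩ := hV.eq_mul_realWeight_Ioo
  exact pearsonFunctional_interval measurableSet_Ioo (by simp) hc0 hc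
    (fun f _ => integrableOn_eval_mul_realWeight_Ioo ha hb f)
    (fun g _ => integral_pearson_Ioo ha hb g)

/-! ### The half-line `(-∞, -1)` -/

theorem integrableOn_comp_neg {E : Type*} [NormedAddCommGroup E] {f : ℝ → E} {S : Set ℝ} :
    IntegrableOn (fun t => f (-t)) (-S) ↔ IntegrableOn f S :=
  (Measure.measurePreserving_neg (volume : Measure ℝ)).integrableOn_comp_preimage
    (MeasurableEquiv.neg ℝ).measurableEmbedding

theorem integral_comp_neg_set {f : ℝ → ℂ} {S : Set ℝ} :
    ∫ t in -S, f (-t) = ∫ t in S, f t :=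
  (Measure.measurePreserving_neg (volume : Measure ℝ)).setIntegral_preimage_emb
    (MeasurableEquiv.neg ℝ).measurableEmbedding f S

theorem realWeight_eq_of_lt (a b : ℝ) {t : ℝ} (ht : t < -1) :
    realWeight a b t = (1 - t) ^ a * (-1 - t) ^ b := by
  rw [realWeight, Real.rpow_def_of_pos (by linarith), Real.rpow_def_of_pos (by linarith),
    ← Real.exp_add, ← Real.log_neg_eq_log (1 + t), neg_add']
  congr 1; ring

theorem integrableOn_eval_mul_realWeight_bounded (a : ℝ) {b : ℝ} (hb : -1 < b) (f : ℂ[X]) {R : ℝ}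
    (hR : 1 ≤ R) :
    IntegrableOn (fun t : ℝ => f.eval (t : ℂ) * realWeight a b t) (Ioo (-R) (-1)) := by
  have h1 : IntegrableOn (fun t : ℝ => (-1 - t) ^ b) (Ioo (-R) (-1)) := by
    have := (intervalIntegral.intervalIntegrable_rpow' hb (a := R - 1) (b := 0)).comp_sub_left (-1)
    simp only [sub_zero, show -1 - (R - 1) = -R by ring] at this
    exact (intervalIntegrable_iff_integrableOn_Ioo_of_le (by linarith)).1 this
  have h1' : IntegrableOn (fun t : ℝ => (((-1 - t) ^ b : ℝ) : ℂ)) (Ioo (-R) (-1)) := h1.ofReal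
  have h2 : ContinuousOn (fun t : ℝ => f.eval (t : ℂ) * ((1 - t) ^ a : ℝ)) (Icc (-R) (-1)) := by
    refine (f.continuous.comp Complex.continuous_ofReal).continuousOn.mul
      (Complex.continuous_ofReal.comp_continuousOn fun t ht => ?_)
    exact (ContinuousAt.rpow_const (by fun_prop)
      (Or.inl (by linarith [ht.2]))).continuousWithinAt
  refine (IntegrableOn.continuousOn_mul_of_subset h2 h1' isCompact_Icc measurableSet_Ioo
    Ioo_subset_Icc_self).congr_fun (fun t ht => ?_) measurableSet_Ioo
  simp only [realWeight_eq_of_lt a b ht.2]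
  push_cast; ring

theorem tendsto_eval_neg_div (f : ℂ[X]) {M : ℕ} (hf : f.natDegree ≤ M) :
    Tendsto (fun x : ℝ => f.eval (((-x : ℝ)) : ℂ) / (x : ℂ) ^ M) atTop
      (𝓝 ((-1) ^ M * f.coeff M)) := by
  have h : Tendsto (fun x : ℝ => ∑ i ∈ Finset.range (M + 1),
      f.coeff i * (-1) ^ i * (((x ^ (M - i))⁻¹ : ℝ) : ℂ)) atTop
      (𝓝 (∑ i ∈ Finset.range (M + 1), if i = M then f.coeff M * (-1) ^ M else 0)) := by
    refine tendsto_finsetSum _ fun i hi => ?_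
    have hiM := Nat.lt_succ_iff.1 (Finset.mem_range.1 hi)
    split_ifs with h
    · subst h; simp
    · have h0 : Tendsto (fun x : ℝ => (x ^ (M - i))⁻¹) atTop (𝓝 0) :=
        tendsto_inv_atTop_zero.comp (tendsto_pow_atTop (by omega))
      have := ((Complex.continuous_ofReal.tendsto 0).comp h0).const_mul (f.coeff i * (-1) ^ i)
      simpa [Function.comp_def] using this
  rw [Finset.sum_ite_eq', if_pos (by simp), mul_comm] at h
  refine h.congr' ?_
  filter_upwards [eventually_gt_atTop 0] with x hx
  have hx' : (x : ℂ) ≠ 0 := by exact_mod_cast hx.ne'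
  rw [eval_eq_sum_range' (Nat.lt_succ_of_le hf), Finset.sum_div]
  refine Finset.sum_congr rfl fun i hi => ?_
  have hiM := Nat.lt_succ_iff.1 (Finset.mem_range.1 hi)
  obtain ⟨j, rfl⟩ := Nat.exists_eq_add_of_le hiM
  rw [Nat.add_sub_cancel_left]
  push_cast
  rw [neg_pow (x : ℂ), pow_add]
  field_simp

theorem tendsto_realWeight_neg_div (a b : ℝ) :
    Tendsto (fun x : ℝ => realWeight a b (-x) / x ^ (a + b)) atTop (𝓝 1) := by
  have h : Tendsto (fun x : ℝ => Real.exp (a * (Real.log (x + 1) - Real.log x) +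
      b * (Real.log (x + -1) - Real.log x))) atTop (𝓝 (Real.exp (a * 0 + b * 0))) :=
    (Real.continuous_exp.tendsto _).comp (((Real.tendsto_log_comp_add_sub_log 1).const_mul a).add
      ((Real.tendsto_log_comp_add_sub_log (-1)).const_mul b))
  simp only [mul_zero, add_zero, Real.exp_zero] at h
  refine h.congr' ?_
  filter_upwards [eventually_gt_atTop 0] with x hx
  rw [realWeight, Real.rpow_def_of_pos hx, ← Real.exp_sub, sub_neg_eq_add, ← Real.log_neg_eq_log (1 + -x),
    show -(1 + -x) = x + -1 by ring, add_comm 1 x]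
  congr 1; ring

theorem tendsto_eval_mul_realWeight_div (a b : ℝ) (f : ℂ[X]) {M : ℕ} (hf : f.natDegree ≤ M) :
    Tendsto (fun t : ℝ => f.eval (t : ℂ) * realWeight a b t / (((-t) ^ (M + a + b) : ℝ) : ℂ)) atBot
      (𝓝 ((-1) ^ M * f.coeff M)) := by
  have h := (tendsto_eval_neg_div f hf).mul
    ((Complex.continuous_ofReal.tendsto 1).comp (tendsto_realWeight_neg_div a b))
  rw [Complex.ofReal_one, mul_one] at h
  refine (h.comp tendsto_neg_atBot_atTop).congr' ?_
  filter_upwards [eventually_lt_atBot 0] with t ht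
  have ht' : 0 < -t := by linarith
  have ht'' : (t : ℂ) ≠ 0 := by exact_mod_cast ht.ne
  rw [add_assoc, Real.rpow_add ht', Real.rpow_natCast]
  simp only [Function.comp, neg_neg]
  push_cast
  rw [div_mul_div_comm]

/-- Comparison with `(-t)^(N + a + b)` handles infinity, and `b > -1` handles the end `-1`. -/
theorem integrableOn_eval_mul_realWeight_Iio {a b : ℝ} (hb : -1 < b) {N : ℕ} (hN : N + a + b < -1)
    (f : ℂ[X]) (hf : f.natDegree ≤ N) :
    IntegrableOn (fun t : ℝ => f.eval (t : ℂ) * realWeight a b t) (Iio (-1)) := by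
  have h1 : IntegrableOn (fun t : ℝ => (-t) ^ (N + a + b)) (Iio (-1)) := by
    have := (integrableOn_comp_neg (f := fun t : ℝ => t ^ (N + a + b)) (S := Ioi 1)).2
      (integrableOn_Ioi_rpow_of_lt hN one_pos)
    simpa using this
  have h2 : IntegrableOn (fun t : ℝ => f.eval (t : ℂ) * realWeight a b t) (Iic (-2)) := by
    refine LocallyIntegrableOn.integrableOn_of_isBigO_atBot
      (g := fun t : ℝ => (((-t) ^ (N + a + b) : ℝ) : ℂ)) ?_ ?_
      ⟨Iio (-1), Iio_mem_atBot _, h1.ofReal⟩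
    · refine (continuousOn_eval_mul_realWeight a b f fun t ht => ?_).locallyIntegrableOn
        measurableSet_Iic
      have : t ≤ -2 := ht
      constructor <;> intro h <;> linarith
    · refine Asymptotics.isBigO_of_div_tendsto_nhds ?_ _ (tendsto_eval_mul_realWeight_div a b f hf)
      filter_upwards [eventually_lt_atBot 0] with t ht h0
      have := Real.rpow_pos_of_pos (by linarith : 0 < -t) (N + a + b)
      exact absurd h0 (by exact_mod_cast this.ne')
  refine (h2.union (integrableOn_eval_mul_realWeight_bounded a hb f (R := 3)
    (by norm_num))).mono_set fun t ht => ?_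
  rcases le_or_gt t (-2) with h | h
  · exact Or.inl h
  · exact Or.inr ⟨by linarith, ht⟩

theorem integral_pearson_Iio {a b : ℝ} (hb : -1 < b) {N : ℕ} (hN : N + a + b < -1)
    {g : ℂ[X]} (hg : g.natDegree < N) :
    ∫ t in Iio (-1 : ℝ), (pearson a b g).eval (t : ℂ) * realWeight a b t = 0 := by
  have hcont : ContinuousAt (fun t : ℝ =>
      ((-((1 - t) ^ (a + 1) * (-1 - t) ^ (b + 1)) : ℝ) : ℂ) * g.eval (t : ℂ)) (-1) := by
    refine (Complex.continuous_ofReal.continuousAt.comp (ContinuousAt.mul ?_ ?_).neg).mul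
      (g.continuous.comp Complex.continuous_ofReal).continuousAt
    · exact ContinuousAt.rpow_const (by fun_prop) (Or.inl (by norm_num))
    · exact ContinuousAt.rpow_const (by fun_prop) (Or.inr (by linarith))
  have hE : ∀ t ∈ Iio (-1 : ℝ), ((-((1 - t) ^ (a + 1) * (-1 - t) ^ (b + 1)) : ℝ) : ℂ) *
      g.eval (t : ℂ) = (1 - (t : ℂ) ^ 2) * g.eval (t : ℂ) * realWeight a b t := by
    intro t ht
    have ht' : t < -1 := ht
    rw [realWeight_eq_of_lt a b ht, Real.rpow_add_one (by linarith),
      Real.rpow_add_one (by linarith)]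
    push_cast; ring
  have hlim : Tendsto (fun t : ℝ => (1 - (t : ℂ) ^ 2) * g.eval (t : ℂ) * realWeight a b t)
      atBot (𝓝 0) := by
    have h1 := tendsto_eval_mul_realWeight_div a b _ (natDegree_one_sub_X_sq_mul_le hg)
    have h2 : Tendsto (fun t : ℝ => (((-t) ^ (((N + 1 : ℕ) : ℝ) + a + b) : ℝ) : ℂ)) atBot (𝓝 0) := by
      have := (tendsto_rpow_neg_atTop (y := -(((N + 1 : ℕ) : ℝ) + a + b))
        (by push_cast; linarith)).comp tendsto_neg_atBot_atTop
      rw [neg_neg] at this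
      exact (Complex.continuous_ofReal.tendsto 0).comp this
    have h3 := h1.mul h2
    rw [mul_zero] at h3
    refine h3.congr' ?_
    filter_upwards [eventually_lt_atBot 0] with t ht
    have := Real.rpow_pos_of_pos (by linarith : 0 < -t) (((N + 1 : ℕ) : ℝ) + a + b)
    rw [div_mul_cancel₀ _ (by exact_mod_cast this.ne')]
    simp
  have h := integral_Iic_of_hasDerivAt_of_tendsto (a := (-1 : ℝ)) ?_
    (fun t ht => hasDerivAt_pearson_real a b g (t := t) ?_ ?_) ?_ hlim
  · rw [integral_Iic_eq_integral_Iio] at h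
    rw [h]; simp
  -- At `t = -1` the convention `log 0 = 0` keeps `realWeight` finite, so the factor `1 - t²` makes
  -- the antiderivative vanish there, in agreement with its limit.
  · rw [← continuousWithinAt_Iio_iff_Iic]
    have := hcont.tendsto.mono_left (nhdsWithin_le_nhds (s := Iio (-1)))
    refine (this.congr' ?_).trans_eq ?_
    · filter_upwards [self_mem_nhdsWithin] using hE
    · simp [Real.zero_rpow (by linarith : b + 1 ≠ 0)]
  · have : t < -1 := ht
    intro h; linarith
  · have : t < -1 := ht
    intro h; linarith
  · rw [integrableOn_Iic_iff_integrableOn_Iio]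
    exact integrableOn_eval_mul_realWeight_Iio hb hN _ ((natDegree_pearson_le _ _ _).trans hg)

theorem IsWeightBranch.pearsonFunctional_Iio {a b : ℝ} (hb : -1 < b) {N : ℕ}
    (hN : N + a + b < -1) {V : ℝ → ℂ}
    (hV : IsWeightBranch a b (fun t => (t : ℂ)) (Iio (-1)) V) :
    PearsonFunctional a b N (fun f L =>
      IntegrableOn (fun t : ℝ => f.eval (t : ℂ) * V t) (Iio (-1)) ∧
        ∫ t in Iio (-1 : ℝ), f.eval (t : ℂ) * V t = L) := by
  obtain ⟨c, hc0, hc⟩ := hV.eq_mul_realWeight_Iio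
  exact pearsonFunctional_interval measurableSet_Iio (by simp) hc0 hc
    (fun f hf => integrableOn_eval_mul_realWeight_Iio hb hN f hf)
    (fun g hg => integral_pearson_Iio hb hN hg)

/-! ### Divergence at infinity -/

/-- The Cauchy criterion fails on the blocks `[-2R, -R]`: after division by `C`, the real part of
the integral over each late block is at least `1/4`. Lebesgue integrability would force convergence
of the truncated integrals, so it fails too. -/
theorem divergesOn_Iio_of_tendsto {h : ℝ → ℂ} {s : ℝ} (hs : -1 < s) {C : ℂ} (hC : C ≠ 0)
    (hint : ∀ R : ℝ, 1 ≤ R → IntegrableOn h (Ioo (-R) (-1)))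
    (hlim : Tendsto (fun t : ℝ => h t / (((-t) ^ s : ℝ) : ℂ)) atBot (𝓝 C)) :
    DivergesOn (Iio (-1)) h := by
  have key : ¬ ∃ L : ℂ, Tendsto (fun R : ℝ => ∫ t in Iio (-1) ∩ Icc (-R) R, h t) atTop (𝓝 L) := by
    rintro ⟨L, hL⟩
    have h2R : Tendsto (fun R : ℝ => 2 * R) atTop atTop :=
      tendsto_id.const_mul_atTop (by norm_num)
    have hdiff := (((hL.comp h2R).sub hL).div_const C)
    rw [sub_self, zero_div] at hdiff
    have hre := (Complex.continuous_re.tendsto 0).comp hdiff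
    have hlt := hre.eventually_lt_const (u := 1 / 4) (by norm_num)
    have hlim1 : ∀ᶠ t : ℝ in atBot, 1 / 2 < (h t / (((-t) ^ s : ℝ) : ℂ) / C).re := by
      have h1 := hlim.div_const C
      rw [div_self hC] at h1
      exact ((Complex.continuous_re.tendsto 1).comp h1).eventually_const_lt (by norm_num)
    obtain ⟨T, hT⟩ := eventually_atBot.1 hlim1
    obtain ⟨R, hR, hRT, hR1⟩ :=
      (hlt.and ((eventually_ge_atTop (-T)).and (eventually_gt_atTop 1))).exists
    have hIR : ∀ R : ℝ, 1 < R → Iio (-1 : ℝ) ∩ Icc (-R) R = Ico (-R) (-1) := fun R hR => by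
      ext t
      simp only [mem_inter_iff, mem_Iio, mem_Icc, mem_Ico]
      constructor
      · rintro ⟨h1, h2, h3⟩; exact ⟨h2, h1⟩
      · rintro ⟨h1, h2⟩; exact ⟨h2, h1, by linarith⟩
    have hbig : IntegrableOn h (Ico (-(2 * R)) (-1)) := by
      rw [integrableOn_Ico_iff_integrableOn_Ioo]
      exact hint _ (by linarith)
    have hsub1 : Ico (-(2 * R)) (-R) ⊆ Ico (-(2 * R)) (-1) := Ico_subset_Ico_right (by linarith)
    have hsub2 : Ico (-R) (-1) ⊆ Ico (-(2 * R)) (-1) := Ico_subset_Ico_left (by linarith)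
    have hsplit : (∫ t in Ico (-(2 * R)) (-1), h t) - ∫ t in Ico (-R) (-1), h t =
        ∫ t in Ico (-(2 * R)) (-R), h t := by
      rw [← Ico_union_Ico_eq_Ico (by linarith : -(2 * R) ≤ -R) (by linarith : -R ≤ -1),
        setIntegral_union (Set.disjoint_left.2 fun t h1 h2 => not_lt.2 h2.1 h1.2) measurableSet_Ico
          (hbig.mono_set hsub1) (hbig.mono_set hsub2), add_sub_cancel_right]
    simp only [Function.comp] at hR
    rw [hIR _ (by linarith), hIR _ hR1, hsplit, ← integral_div] at hR
    have hRint := (hbig.mono_set hsub1).div_const C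
    have hre' : (∫ t in Ico (-(2 * R)) (-R), h t / C).re =
        ∫ t in Ico (-(2 * R)) (-R), (h t / C).re := by
      exact (integral_re hRint).symm
    rw [hre'] at hR
    -- On the block the real part exceeds `(-t)^s / 2`, and `(-t)^s ≥ (-t)⁻¹ ≥ 1 / (2R)` because `s
    -- > -1` and `-t ≥ 1`.
    have hlow : ∫ t in Ico (-(2 * R)) (-R), (1 / (4 * R) : ℝ) ≤
        ∫ t in Ico (-(2 * R)) (-R), (h t / C).re := by
      refine setIntegral_mono_on (continuous_const.integrableOn_Icc.mono_set Ico_subset_Icc_self) hRint.re measurableSet_Ico fun t ht => ?_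
      have ht1 : 1 ≤ -t := by linarith [ht.2]
      have ht0 : 0 < -t := by linarith
      have hpos := Real.rpow_pos_of_pos ht0 s
      have h1 := hT t (by linarith [ht.2])
      rw [div_right_comm, Complex.div_ofReal_re, lt_div_iff₀ hpos] at h1
      have h2 : (-t) ^ (-1 : ℝ) ≤ (-t) ^ s := Real.rpow_le_rpow_of_exponent_le ht1 hs.le
      rw [Real.rpow_neg_one] at h2
      have h3 : (2 * R)⁻¹ ≤ (-t)⁻¹ := inv_anti₀ ht0 (by linarith [ht.1])
      have h4 : 1 / (4 * R) = 1 / 2 * (2 * R)⁻¹ := by field_simp; norm_num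
      rw [h4]
      linarith
    rw [setIntegral_const, Real.volume_real_Ico_of_le (by linarith), smul_eq_mul] at hlow
    have : (-R - -(2 * R)) * (1 / (4 * R)) = 1 / 4 := by
      have : R ≠ 0 := by linarith
      field_simp; ring
    linarith
  refine ⟨fun hI => key ?_, key⟩
  have hU : ⋃ R : ℝ, Iio (-1 : ℝ) ∩ Icc (-R) R = Iio (-1) := by
    rw [← inter_iUnion]
    refine inter_eq_left.2 fun t _ => mem_iUnion.2 ⟨|t|, ?_⟩
    exact ⟨neg_abs_le t, le_abs_self t⟩
  refine ⟨_, tendsto_setIntegral_of_monotone (fun R => measurableSet_Iio.inter measurableSet_Icc)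
    (fun R R' hRR' => ?_) (by rwa [hU])⟩
  exact inter_subset_inter_right _ (Icc_subset_Icc (neg_le_neg hRR') hRR')

theorem IsWeightBranch.divergesOn_Iio {a b : ℝ} (hb : -1 < b) {V : ℝ → ℂ}
    (hV : IsWeightBranch a b (fun t => (t : ℂ)) (Iio (-1)) V) {f : ℂ[X]} (hf : f ≠ 0)
    (hs : -1 < f.natDegree + a + b) :
    DivergesOn (Iio (-1)) (fun t : ℝ => f.eval (t : ℂ) * V t) := by
  obtain ⟨c, hc0, hc⟩ := hV.eq_mul_realWeight_Iio
  refine divergesOn_Iio_of_tendsto hs (C := c * ((-1) ^ f.natDegree * f.leadingCoeff))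
    (mul_ne_zero hc0 (mul_ne_zero (by simp) (leadingCoeff_ne_zero.2 hf))) (fun R hR => ?_) ?_
  · refine IntegrableOn.congr_fun ((integrableOn_eval_mul_realWeight_bounded a hb f hR).const_mul c)
      (fun t ht => ?_) measurableSet_Ioo
    simp only [hc t ht.2]; ring
  · refine ((tendsto_eval_mul_realWeight_div a b f le_rfl).const_mul c).congr' ?_
    filter_upwards [Iio_mem_atBot (-1)] with t ht
    rw [hc t ht]; ring

/-! ### Multiple orthogonality from the two functionals -/

theorem natDegree_mul_le_of_degree {p q : ℂ[X]} {n m N : ℕ} (hp : p.degree ≤ n) (hq : q.degree < m)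
    (hN : n + m ≤ N + 1) : (q * p).natDegree ≤ N := by
  by_cases hq0 : q = 0
  · simp [hq0]
  have h1 := natDegree_le_of_degree_le hp
  have h2 := (natDegree_lt_iff_degree_lt hq0).2 hq
  refine natDegree_mul_le.trans ?_
  omega

theorem NonInt.of_real {α β : ℝ} (hα : ∀ m : ℤ, α ≠ m) (hβ : ∀ m : ℤ, β ≠ m)
    (hαβ : ∀ m : ℤ, α + β ≠ m) : NonInt α β where
  left m h := hα m (by exact_mod_cast h)
  right m h := hβ m (by exact_mod_cast h)
  sum m h := hαβ m (by exact_mod_cast h)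

/-- The four analytic inputs differ only in the degree they must reach: `n + k - 1` on the curve,
`2n - k - 1` for orthogonality on the interval, and `2n - k` for the nonvanishing or divergent
integral. -/
theorem multipleOrthogonality_of_pearsonFunctional {n k : ℕ} {α β : ℝ} (hk : k ≤ n)
    (h : NonInt α β) {IsGamma : (ℝ → ℂ) → Prop} {Δ : Set ℝ}
    (hcurve : ∀ γ W, IsGamma γ → IsWeightBranch α β γ (Ioo 0 1) W → ∃ N, n + k ≤ N + 1 ∧
      PearsonFunctional α β N (fun f a => HasCurveIntegral γ (fun s => f.eval (γ s) * W s) a))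
    (hint : ∀ V, IsWeightBranch α (β + k) (fun t => (t : ℂ)) Δ V → ∃ N, n + (n - k) ≤ N + 1 ∧
      PearsonFunctional α (β + k : ℝ) N (fun f L =>
        IntegrableOn (fun t : ℝ => f.eval (t : ℂ) * V t) Δ ∧ ∫ t in Δ, f.eval (t : ℂ) * V t = L))
    (hint' : ∀ V, IsWeightBranch α (β + k) (fun t => (t : ℂ)) Δ V →
      ¬ (-1 < 2 * n + α + β ∧ 2 * n + α + β < 0) → ∃ N, n + (n - k) ≤ N ∧
      PearsonFunctional α (β + k : ℝ) N (fun f L =>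
        IntegrableOn (fun t : ℝ => f.eval (t : ℂ) * V t) Δ ∧ ∫ t in Δ, f.eval (t : ℂ) * V t = L))
    (hdiv : ∀ V, IsWeightBranch α (β + k) (fun t => (t : ℂ)) Δ V →
      -1 < 2 * n + α + β ∧ 2 * n + α + β < 0 → ∀ f : ℂ[X], f ≠ 0 → f.natDegree = n + (n - k) →
      DivergesOn Δ (fun t : ℝ => f.eval (t : ℂ) * V t)) :
    MultipleOrthogonality n α β IsGamma Δ α (β + k) k := by
  intro γ W V hγ hW hV
  have hsum : ∀ m : ℤ, (α : ℂ) + (β + k : ℝ) ≠ m := fun m hm => h.sum (m - k) (by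
    push_cast at hm ⊢; linear_combination hm)
  have hcast : ((β + k : ℝ) : ℂ) = (β : ℂ) + k := by push_cast; rfl
  have hR : ∀ q p : ℂ[X], realIntegrand V q p = fun t : ℝ => (q * p).eval (t : ℂ) * V t :=
    fun q p => by funext t; simp [realIntegrand]
  have hO1 : ∀ p : ℂ[X], p.degree ≤ n → (OrthOnCurve γ W k p ↔
      ∀ q : ℂ[X], q.degree < k → q * p ∈ LinearMap.range (pearson α β)) := by
    intro p hp
    obtain ⟨N, hN, hH⟩ := hcurve γ W hγ hW
    refine forall₂_congr fun q hq => ?_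
    rw [← hH.eq_zero_iff h.sum (natDegree_mul_le_of_degree hp hq hN)]
    simp only [eval_mul]
  have hO2 : ∀ p : ℂ[X], p.degree ≤ n → (OrthOnInterval Δ V (n - k) p ↔
      ∀ q : ℂ[X], q.degree < (n - k : ℕ) → q * p ∈ LinearMap.range (pearson α (β + k))) := by
    intro p hp
    obtain ⟨N, hN, hH⟩ := hint V hV
    refine forall₂_congr fun q hq => ?_
    rw [← hcast, ← hH.eq_zero_iff hsum (natDegree_mul_le_of_degree hp hq hN), hR]
  have hO : ∀ p : ℂ[X], p.degree ≤ n → (OrthOnCurve γ W k p ∧ OrthOnInterval Δ V (n - k) p ↔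
      ∀ q : ℂ[X], q.degree < n → q * p ∈ LinearMap.range (pearson α β)) := by
    intro p hp
    rw [hO1 p hp, hO2 p hp, forall_mul_mem_range_iff hk h.right]
  have hJdeg := degree_jacobi n h
  have hJ := (hO _ hJdeg.le).2 fun q hq => mul_jacobi_mem_range h hq
  refine ⟨hJ.1, hJ.2, fun q hq => ⟨fun hs => ?_, fun hs => ?_⟩, fun p hp => ?_⟩
  · obtain ⟨N, hN, hH⟩ := hint' V hV hs
    have hdeg : (q * jacobi n α β).natDegree ≤ N := by
      refine natDegree_mul_le.trans ?_
      rw [natDegree_eq_of_degree_eq_some hq, natDegree_eq_of_degree_eq_some hJdeg]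
      omega
    obtain ⟨a, ⟨ha1, ha2⟩, ha⟩ := hH.exists_value hsum hdeg
    rw [hR]
    refine ⟨ha1, ?_⟩
    -- Nonvanishing for the exponent `β + k` is moved back to `β`, where the test polynomial `(1 +
    -- X)^k q` has degree exactly `n`.
    rw [ha2, Ne, ha, hcast, ← one_add_X_pow_mul_mem_range h.right, ← mul_assoc]
    refine mul_jacobi_notMem_range h ?_
    rw [add_comm (1 : ℂ[X]), ← C_1, degree_mul, degree_pow, degree_X_add_C, nsmul_one, hq, ← Nat.cast_add,
      Nat.add_sub_cancel' hk]
  · have hq0 : q ≠ 0 := by rintro rfl; simp at hq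
    have hJ0 : jacobi n α β ≠ 0 := by intro h0; simp [h0] at hJdeg
    rw [hR]
    refine hdiv V hV hs _ (mul_ne_zero hq0 hJ0) ?_
    rw [natDegree_mul hq0 hJ0, natDegree_eq_of_degree_eq_some hq,
      natDegree_eq_of_degree_eq_some hJdeg, add_comm]
  · rw [hO p hp]
    constructor
    · exact eq_C_mul_jacobi h hp
    · rintro ⟨c, rfl⟩ q hq
      rw [mul_left_comm, ← smul_eq_C_mul]
      exact Submodule.smul_mem _ _ (mul_jacobi_mem_range h hq)

theorem multipleOrthogonality_gammaOne {n k : ℕ} {α β : ℝ} (hk : k ≤ n) (h : NonInt α β)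
    (hβ : ∀ m : ℤ, β ≠ m) (hα : -1 < α) (hβk : -1 < β + k)
    (hs : ¬ 2 * n + α + β < 0) :
    MultipleOrthogonality n α β IsGammaOne (Ioo (-1) 1) α (β + k) k :=
  multipleOrthogonality_of_pearsonFunctional hk h
    (fun _ _ hγ hW => ⟨n + k + 2, by omega, hγ.pearsonFunctional hW hα hβk hβ (by omega)⟩)
    (fun _ hV => ⟨2 * n, by omega, hV.pearsonFunctional_Ioo hα hβk _⟩)
    (fun _ hV _ => ⟨2 * n, by omega, hV.pearsonFunctional_Ioo hα hβk _⟩)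
    (fun _ _ h => absurd h.2 hs)

/-- Only polynomials of limited degree are admissible at infinity. The bound `2n + α + β < 0` allows
degree `2n - 1` on the curve and `2n - k - 1` on the half-line; degree `2n - k` on the half-line
needs `2n + α + β < -1`. -/
theorem multipleOrthogonality_gammaInfty {n k : ℕ} {α β : ℝ} (hk : k < n) (hk1 : 1 ≤ k)
    (h : NonInt α β) (hβ : ∀ m : ℤ, β ≠ m) (hαβ : ∀ m : ℤ, α + β ≠ m) (hβk : -1 < β + k)
    (hs : 2 * n + α + β < 0) :
    MultipleOrthogonality n α β IsGammaInftyUnoriented (Iio (-1)) α (β + k) k := by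
  have hcast : ((n - k : ℕ) : ℝ) = n - k := Nat.cast_sub hk.le
  refine multipleOrthogonality_of_pearsonFunctional hk.le h (fun γ W hγ hW => ?_)
    (fun V hV => ?_) (fun V hV hs' => ?_) fun V hV hs' f hf0 hf => ?_
  · obtain ⟨m, rfl⟩ := Nat.exists_eq_add_of_le' (show 1 ≤ n by omega)
    refine ⟨2 * m + 1, by omega, hγ.pearsonFunctional hW hβk hβ ?_ (by omega)⟩
    push_cast at hs ⊢; linarith
  · obtain ⟨m, hm⟩ := Nat.exists_eq_add_of_le' (show 1 ≤ n - k by omega)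
    refine ⟨n + m, by omega, hV.pearsonFunctional_Iio hβk ?_⟩
    rw [hm] at hcast
    push_cast at hcast ⊢; linarith
  · refine ⟨n + (n - k), le_rfl, hV.pearsonFunctional_Iio hβk ?_⟩
    -- The borderline value `-1` is excluded because `α + β` is not an integer.
    have hne : 2 * n + α + β ≠ -1 := fun he => hαβ (-1 - 2 * n) (by push_cast; linarith)
    have hlt : 2 * n + α + β < -1 :=
      lt_of_le_of_ne (not_lt.1 fun h1 => hs' ⟨h1, hs⟩) hne
    push_cast [hcast]; linarith
  · refine hV.divergesOn_Iio hβk hf0 ?_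
    rw [hf]
    push_cast [hcast]; linarith [hs'.1]

/-! ### Reflection -/

/-- The reflection `p(z) ↦ (-1)ⁿ p(-z)`. -/
def reflection (n : ℕ) (p : ℂ[X]) : ℂ[X] := C ((-1) ^ n) * p.comp (-X)

theorem eval_reflection (n : ℕ) (p : ℂ[X]) (z : ℂ) :
    (reflection n p).eval z = (-1) ^ n * p.eval (-z) := by
  simp [reflection]

theorem eval_reflection_mul (n : ℕ) (q p : ℂ[X]) (z : ℂ) :
    (reflection n q).eval z * (reflection n p).eval z = q.eval (-z) * p.eval (-z) := by
  rw [eval_reflection, eval_reflection, mul_mul_mul_comm, ← mul_pow]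
  simp

theorem reflection_reflection (n : ℕ) (p : ℂ[X]) : reflection n (reflection n p) = p := by
  refine Polynomial.funext fun z => ?_
  rw [eval_reflection, eval_reflection, ← mul_assoc, ← mul_pow]
  simp

theorem degree_reflection (n : ℕ) (p : ℂ[X]) : (reflection n p).degree = p.degree := by
  have h : ((-1 : ℂ)) ^ n ≠ 0 := by simp
  by_cases hp : p = 0
  · simp [hp, reflection]
  have h0 : reflection n p ≠ 0 := fun h => hp (by
    rw [← reflection_reflection n p, h]; simp [reflection])
  rw [degree_eq_natDegree h0, degree_eq_natDegree hp, reflection, natDegree_C_mul h,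
    natDegree_comp, natDegree_neg, natDegree_X, mul_one]

theorem reflection_C_mul (n : ℕ) (c : ℂ) (p : ℂ[X]) :
    reflection n (C c * p) = C c * reflection n p := by
  simp only [reflection, mul_comp, C_comp]; ring

theorem reflection_jacobi (n : ℕ) (α β : ℂ) : reflection n (jacobi n α β) = jacobi n β α := by
  refine Polynomial.funext fun z => ?_
  rw [eval_reflection, jacobi, jacobi, eval_mul, eval_mul, eval_finsetSum, eval_finsetSum,
    ← Finset.sum_range_reflect, mul_left_comm, Finset.mul_sum]
  simp only [eval_C]
  congr 1
  refine Finset.sum_congr rfl fun k hk => ?_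
  obtain ⟨l, rfl⟩ := Nat.exists_eq_add_of_le (Nat.lt_succ_iff.1 (Finset.mem_range.1 hk))
  have e1 : k + l + 1 - 1 - k = l := by omega
  have e2 : k + l - l = k := by omega
  have e3 : k + l - k = l := by omega
  rw [e1, e2, e3]
  simp only [eval_mul, eval_pow, eval_sub, eval_add, eval_one, eval_X, eval_C]
  rw [show -z - 1 = -1 * (z + 1) by ring, show -z + 1 = -1 * (z - 1) by ring, mul_pow, mul_pow,
    pow_add]
  have h1 : ((-1 : ℂ) ^ k) * (-1) ^ k = 1 := by rw [← mul_pow]; simp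
  have h2 : ((-1 : ℂ) ^ l) * (-1) ^ l = 1 := by rw [← mul_pow]; simp
  linear_combination (Ring.choose (((k + l : ℕ) : ℂ) + α) k *
    Ring.choose (((k + l : ℕ) : ℂ) + β) l * (z + 1) ^ l * (z - 1) ^ k) *
      (((-1) ^ l * (-1) ^ l) * h1 + h2)

/-- Reflecting the curve changes the sign of its derivative, and hence of the integral, which does
not affect the value zero. -/
theorem HasCurveIntegral.neg_curve {γ f : ℝ → ℂ} (h : HasCurveIntegral γ f 0) :
    HasCurveIntegral (fun s => -γ s) f 0 := by
  refine ⟨h.1.neg.congr (.of_forall fun s => by simp), ?_⟩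
  have := h.2.neg
  rw [neg_zero] at this
  refine this.congr fun e => ?_
  rw [← intervalIntegral.integral_neg]
  simp

theorem OrthOnCurve.reflection {γ W : ℝ → ℂ} {k : ℕ} {p : ℂ[X]} (n : ℕ)
    (h : OrthOnCurve γ W k p) : OrthOnCurve (fun s => -γ s) W k (JacobiOrth.reflection n p) := by
  intro q hq
  have := (h (JacobiOrth.reflection n q) (by rwa [degree_reflection])).neg_curve
  refine hasCurveIntegral_congr this fun s _ => ?_
  have h1 := eval_reflection_mul n q (JacobiOrth.reflection n p) (γ s)
  rw [reflection_reflection] at h1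
  rw [h1]

theorem realIntegrand_reflection (V : ℝ → ℂ) (n : ℕ) (q p : ℂ[X]) :
    realIntegrand (fun t => V (-t)) (reflection n q) (reflection n p) =
      fun t => realIntegrand V q p (-t) := by
  funext t
  simp only [realIntegrand, eval_reflection_mul, Complex.ofReal_neg]

theorem OrthOnInterval.reflection {Δ : Set ℝ} {V : ℝ → ℂ} {m : ℕ} {p : ℂ[X]} (n : ℕ)
    (h : OrthOnInterval Δ V m p) :
    OrthOnInterval (-Δ) (fun t => V (-t)) m (JacobiOrth.reflection n p) := by
  intro q hq
  obtain ⟨h1, h2⟩ := h (JacobiOrth.reflection n q) (by rwa [degree_reflection])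
  rw [← reflection_reflection n q, realIntegrand_reflection]
  exact ⟨integrableOn_comp_neg.2 h1, integral_comp_neg_set.trans h2⟩

theorem DivergesOn.comp_neg {Δ : Set ℝ} {f : ℝ → ℂ} (h : DivergesOn Δ f) :
    DivergesOn (-Δ) (fun t => f (-t)) := by
  refine ⟨fun h1 => h.1 (integrableOn_comp_neg.1 h1), fun ⟨L, hL⟩ => h.2 ⟨L, ?_⟩⟩
  refine hL.congr fun R => ?_
  rw [← integral_comp_neg_set, Set.inter_neg]
  simp

theorem weightValues_neg (α β : ℝ) (z : ℂ) : weightValues α β z ⊆ weightValues β α (-z) := by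
  rintro w ⟨a, b, ha, hb, rfl⟩
  exact ⟨b, a, by rw [hb]; ring, by rw [ha]; ring, by rw [add_comm]⟩

theorem IsWeightBranch.neg_curve {α β : ℝ} {γ W : ℝ → ℂ} {I : Set ℝ}
    (h : IsWeightBranch α β γ I W) : IsWeightBranch β α (fun s => -γ s) I W :=
  ⟨h.1, fun s hs => weightValues_neg _ _ _ (h.2 s hs)⟩

theorem IsWeightBranch.comp_neg {α β : ℝ} {V : ℝ → ℂ} {Δ : Set ℝ}
    (h : IsWeightBranch α β (fun t => (t : ℂ)) (-Δ) V) :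
    IsWeightBranch β α (fun t => (t : ℂ)) Δ (fun t => V (-t)) := by
  refine ⟨h.1.comp continuous_neg.continuousOn fun t ht => by simpa using ht, fun t ht => ?_⟩
  have := weightValues_neg _ _ _ (h.2 (-t) (by simpa using ht))
  simpa using this

/-- Under `z ↦ -z` the two exponents trade places and Jacobi polynomials go to Jacobi polynomials;
test polynomials are reflected with the same sign `(-1)ⁿ`, so the signs cancel in products. -/
theorem MultipleOrthogonality.reflection {n k : ℕ} {α β α₁ β₁ : ℝ}
    {IsGamma IsGamma' : (ℝ → ℂ) → Prop} {Δ : Set ℝ}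
    (h : MultipleOrthogonality n α β IsGamma Δ α₁ β₁ k)
    (hG : ∀ γ, IsGamma' γ → IsGamma (fun s => -γ s)) :
    MultipleOrthogonality n β α IsGamma' (-Δ) β₁ α₁ k := by
  intro γ W V hγ hW hV
  obtain ⟨h1, h2, h3, h4⟩ := h _ W _ (hG γ hγ) hW.neg_curve hV.comp_neg
  have hO1 : ∀ p, OrthOnCurve γ W k p ↔
      OrthOnCurve (fun s => -γ s) W k (JacobiOrth.reflection n p) := fun p =>
    ⟨fun h => h.reflection n, fun h => by
      simpa only [neg_neg, reflection_reflection] using h.reflection n⟩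
  have hO2 : ∀ p, OrthOnInterval (-Δ) V (n - k) p ↔
      OrthOnInterval Δ (fun t => V (-t)) (n - k) (JacobiOrth.reflection n p) := fun p =>
    ⟨fun h => by simpa only [neg_neg] using h.reflection n, fun h => by
      simpa only [neg_neg, reflection_reflection] using h.reflection n⟩
  have hR : ∀ q, realIntegrand V q (jacobi n β α) = fun t => realIntegrand (fun t => V (-t))
      (JacobiOrth.reflection n q) (jacobi n α β) (-t) := fun q => by
    funext t
    rw [← reflection_jacobi n β α, realIntegrand_reflection]
    simp only [neg_neg]
  refine ⟨?_, ?_, fun q hq => ?_, fun p hp => ?_⟩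
  · rwa [hO1, reflection_jacobi]
  · rwa [hO2, reflection_jacobi]
  · have hs : (2 * n + β + α : ℝ) = 2 * n + α + β := by ring
    obtain ⟨h5, h6⟩ := h3 (JacobiOrth.reflection n q) (by rwa [degree_reflection])
    rw [hs, hR]
    refine ⟨fun hc => ?_, fun hc => (h6 hc).comp_neg⟩
    exact ⟨integrableOn_comp_neg.2 (h5 hc).1, integral_comp_neg_set.trans_ne (h5 hc).2⟩
  · rw [hO1, hO2, h4 _ (by rwa [degree_reflection])]
    refine exists_congr fun c => ?_
    rw [← reflection_jacobi n β α, ← reflection_C_mul]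
    exact ⟨fun h => by simpa only [reflection_reflection] using congrArg (JacobiOrth.reflection n) h,
      fun h => congrArg _ h⟩

theorem IsCurve.neg {γ : ℝ → ℂ} (h : IsCurve γ) : IsCurve (fun s => -γ s) where
  continuousOn := h.continuousOn.neg
  differentiable := by
    obtain ⟨S, hS, hd⟩ := h.differentiable
    exact ⟨S, hS, fun s hs => (hd s hs).neg⟩
  locallyIntegrable := by
    have : deriv (fun s => -γ s) = fun s => -deriv γ s := by funext s; exact deriv.fun_neg
    rw [this]
    exact h.locallyIntegrable.neg

theorem IsGammaNegOne.neg {γ : ℝ → ℂ} (h : IsGammaNegOne γ) : IsGammaOne (fun s => -γ s) where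
  isCurve := h.isCurve.neg
  avoids s hs hc := h.avoids s hs ⟨by simpa using hc.1, by
    have := hc.2; rw [Complex.neg_re] at this; linarith⟩
  start := by simpa using h.start.neg
  start_below := by simpa using h.start_above
  finish := by simpa using h.finish.neg
  finish_above := by simpa using h.finish_below

theorem IsGammaInfty.unoriented {γ : ℝ → ℂ} (h : IsGammaInfty γ) : IsGammaInftyUnoriented γ where
  isCurve := h.isCurve
  avoids := h.avoids
  start := h.start
  finish := h.finish
  sides := Or.inl ⟨h.start_above, h.finish_below⟩

/-- Reflection interchanges the half planes and so reverses the direction of travel. This is the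
reason for working with both orientations. -/
theorem IsGammaInfty.neg_unoriented {γ : ℝ → ℂ} (h : IsGammaInfty γ) :
    IsGammaInftyUnoriented (fun s => -γ s) where
  isCurve := h.isCurve.neg
  avoids s hs hc := h.avoids s hs ⟨by simpa using hc.1, by
    have := hc.2
    rw [Complex.neg_re] at this
    rcases this with h | h
    · right; linarith
    · left; linarith⟩
  start := by simpa using h.start
  finish := by simpa using h.finish
  sides := Or.inr ⟨by simpa using h.start_above, by simpa using h.finish_below⟩

theorem MultipleOrthogonality.mono {n k : ℕ} {α β α₁ β₁ : ℝ}
    {IsGamma IsGamma' : (ℝ → ℂ) → Prop} {Δ : Set ℝ}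
    (h : MultipleOrthogonality n α β IsGamma Δ α₁ β₁ k) (hG : ∀ γ, IsGamma' γ → IsGamma γ) :
    MultipleOrthogonality n α β IsGamma' Δ α₁ β₁ k :=
  fun γ W V hγ => h γ W V (hG γ hγ)

theorem floor_neg_mem {n : ℕ} {β : ℝ} (h : -n < β ∧ β < -1) :
    1 ≤ ⌊-β⌋₊ ∧ ⌊-β⌋₊ < n ∧ -1 < β + ⌊-β⌋₊ := by
  refine ⟨Nat.one_le_floor_iff _ |>.2 (by linarith [h.2]), ?_, ?_⟩
  · rw [Nat.floor_lt (by linarith [h.2])]; linarith [h.1]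
  · have := Nat.lt_floor_add_one (-β); linarith

end JacobiOrth

end

/-! ### The four rows of the table -/

theorem theorem6p1 (n : ℕ) (α β : ℝ)
    (hα : ∀ m : ℤ, α ≠ m) (hβ : ∀ m : ℤ, β ≠ m) (hαβ : ∀ m : ℤ, α + β ≠ m)
    (hone : (-1 < α ∧ ¬ -1 < β ∧ ¬ 2 * n + α + β < 0) ∨
      (¬ -1 < α ∧ -1 < β ∧ ¬ 2 * n + α + β < 0) ∨
      (¬ -1 < α ∧ ¬ -1 < β ∧ 2 * n + α + β < 0))
    (hrange : (-n < α ∧ α < -1) ∨ (-n < β ∧ β < -1)) :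
    (JacobiOrth.jacobi n α β).degree = n ∧
    (-1 < α → -n < β ∧ β < -1 →
      JacobiOrth.MultipleOrthogonality n α β JacobiOrth.IsGammaOne (Set.Ioo (-1) 1)
        α (β + ⌊-β⌋₊) ⌊-β⌋₊) ∧
    (-1 < β → -n < α ∧ α < -1 →
      JacobiOrth.MultipleOrthogonality n α β JacobiOrth.IsGammaNegOne (Set.Ioo (-1) 1)
        (α + ⌊-α⌋₊) β ⌊-α⌋₊) ∧
    (2 * n + α + β < 0 → -n < β ∧ β < -1 →
      JacobiOrth.MultipleOrthogonality n α β JacobiOrth.IsGammaInfty (Set.Iio (-1))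
        α (β + ⌊-β⌋₊) ⌊-β⌋₊) ∧
    (2 * n + α + β < 0 → -n < α ∧ α < -1 →
      JacobiOrth.MultipleOrthogonality n α β JacobiOrth.IsGammaInfty (Set.Ioi 1)
        (α + ⌊-α⌋₊) β ⌊-α⌋₊) := by
  have hαβ' : ∀ m : ℤ, β + α ≠ m := fun m => by rw [add_comm]; exact hαβ m
  have h := JacobiOrth.NonInt.of_real hα hβ hαβ
  have h' := JacobiOrth.NonInt.of_real hβ hα hαβ'
  refine ⟨JacobiOrth.degree_jacobi n h, fun h1 h2 => ?_, fun h1 h2 => ?_, fun h1 h2 => ?_,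
    fun h1 h2 => ?_⟩
  · obtain ⟨-, hk, hβk⟩ := JacobiOrth.floor_neg_mem h2
    exact JacobiOrth.multipleOrthogonality_gammaOne hk.le h hβ h1 hβk (by linarith [h2.1])
  · obtain ⟨-, hk, hαk⟩ := JacobiOrth.floor_neg_mem h2
    -- The rows with `-n < α < -1` are reflections of those with `-n < β < -1`, applied to the pair
    -- `(β, α)`.
    have := (JacobiOrth.multipleOrthogonality_gammaOne hk.le h' hα h1 hαk
      (by linarith [h2.1])).reflection fun _ hγ => JacobiOrth.IsGammaNegOne.neg hγ
    simpa using this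
  · obtain ⟨hk1, hk, hβk⟩ := JacobiOrth.floor_neg_mem h2
    exact (JacobiOrth.multipleOrthogonality_gammaInfty hk hk1 h hβ hαβ hβk h1).mono
      fun _ hγ => hγ.unoriented
  · obtain ⟨hk1, hk, hαk⟩ := JacobiOrth.floor_neg_mem h2
    have := (JacobiOrth.multipleOrthogonality_gammaInfty hk hk1 h' hα hαβ' hαk
      (by linarith)).reflection fun _ hγ => JacobiOrth.IsGammaInfty.neg_unoriented hγ
    simpa using this
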